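/- Let $M$ be a smooth (finite-dimensional, Hausdorff, second countable) manifold, $\Lambda^*M$ the graded algebra of its smooth real differential forms and $\mathfrak X(M)$ its smooth vector fields. For operators $P,Q$ on $\Lambda^*M$, homogeneous of degrees $p,q$, put $[P,Q]=PQ-(-1)^{pq}QP$ and $\daleth P=[d,P]$; $P$ is called $\daleth$-closed if $\daleth P=0$. For a $TM$-valued $k$-form $K$ let $\mathcal I_K$ be the insertion operator (of degree $k-1$, with $\mathcal I_{\alpha\otimes X}\sigma=\alpha\wedge\iota_X\sigma$) and $\mathcal L_K=[\mathcal I_K,d]$. The Frölicher–Nijenhuis bracket $[K,L]_{\mathcal{FN}}$ is the unique smooth $TM$-valued form with $[\mathcal L_K,\mathcal L_L]=\mathcal L_{[K,L]_{\mathcal{FN}}}$. Let $\Phi$ be a smooth endomorphism of $TM$, regarded also as a $TM$-valued $1$-form, such that $R_\Phi=\mathrm{Id}_{TM}+\Phi$ is invertible. Endomorphisms $A$ of $TM$ act on forms by $(A\sigma)(V_1,\dots,V_p)=\sigma(AV_1,\dots,AV_p)$ (trivially on functions). Put $d_\Phi=R_\Phi\, d\, R_\Phi^{-1}$ and $e_\Phi=d_\Phi-d$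 (the canonical solution of the Maurer–Cartan equation associated to $\Phi$). One says that $e_\Phi$ is of finite type $r\in\mathbb N=\{0,1,2,\dots\}$ if $r$ is the least $s\in\mathbb N$ with $\Phi^s[\Phi,\Phi]_{\mathcal{FN}}=0$. The Nijenhuis tensor is $N_\Phi(X,Y)=[\Phi X,\Phi Y]+\Phi^2[X,Y]-\Phi[\Phi X,Y]-\Phi[X,\Phi Y]$ for $X,Y\in\mathfrak X(M)$. **Proposition.** If $R_\Phi$ is invertible, the following are equivalent: (i) $e_\Phi$ is of finite type $0$; (ii) $e_\Phi$ is $\daleth$-closed; (iii) $d_\Phi$ is $\daleth$-closed; (iv) $N_\Phi=0$. **Corollary.** Let $J$ be an almost complex structure on $M$ (a smooth endomorphism of $TM$ with $J^2=-\mathrm{Id}$). Then $R_J$ is invertible, and the following are equivalent: the canonical solution $e_J$ associated to $J$ is of finite type $0$; $N_J=0$; $J$ is integrable, i.e. the subbundle $T^{0,1}=\ker(J+i)$ of $TM\otimes\mathbb C$ is involutive (the Lie bracket of two smooth complex vector fields of type $(0,1)$ is of type $(0,1)$). -/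

import Mathlib

open scoped Manifold ContDiff

noncomputable section

namespace GradedForms

section PointwiseAlgebra

variable {V : Type*} [AddCommGroup V] [Module ℝ V] [TopologicalSpace V]

/-- For `K` an alternating `k`-form with values in `V` and `σ` an alternating form of degree
`m - k + 1`, the (not yet antisymmetrised) `m`-linear map
`(v₀, …, v_{m-1}) ↦ σ (K (v₀, …, v_{k-1}), v_k, …, v_{m-1})`. -/
def insertMultilinear {k m : ℕ} (h : k ≤ m) (K : V [⋀^Fin k]→L[ℝ] V)
    (σ : V [⋀^Fin (m - k + 1)]→L[ℝ] ℝ) :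
    ContinuousMultilinearMap ℝ (fun _ : Fin m => V) ℝ where
  toFun v := σ (Fin.cons (K fun i : Fin k => v ⟨i, by omega⟩)
    fun j : Fin (m - k) => v ⟨k + j, by omega⟩)
  map_update_add' := by
    intro inst v i a b
    obtain rfl : inst = instDecidableEqFin m := Subsingleton.elim _ _
    by_cases hi : (i : ℕ) < k
    · have h1 : ∀ c : V, (fun l : Fin k => Function.update v i c ⟨l, by omega⟩) =
          Function.update (fun l : Fin k => v ⟨l, by omega⟩) ⟨i, hi⟩ c := by
        intro c; ext l
        simp only [Function.update_apply, Fin.ext_iff]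
      have h2 : ∀ c : V, (fun j : Fin (m - k) => Function.update v i c ⟨k + j, by omega⟩) =
          fun j : Fin (m - k) => v ⟨k + j, by omega⟩ := by
        intro c; ext j
        rw [Function.update_of_ne]
        intro hh; simp only [Fin.ext_iff] at hh; omega
      simp only [h1, h2, ContinuousAlternatingMap.map_update_add]
      exact σ.toMultilinearMap.cons_add _ _ _
    · have h1 : ∀ c : V, (fun l : Fin k => Function.update v i c ⟨l, by omega⟩) =
          (fun l : Fin k => v ⟨l, by omega⟩) := by
        intro c; ext l
        rw [Function.update_of_ne]
        intro hh; simp only [Fin.ext_iff] at hh; omega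
      have h2 : ∀ c : V, (fun j : Fin (m - k) => Function.update v i c ⟨k + j, by omega⟩) =
          Function.update (fun j : Fin (m - k) => v ⟨k + j, by omega⟩) ⟨i - k, by omega⟩ c := by
        intro c; ext j
        simp only [Function.update_apply, Fin.ext_iff]
        congr 1
        apply propext; omega
      simp only [h1, h2, Fin.cons_update, ContinuousAlternatingMap.map_update_add]
  map_update_smul' := by
    intro inst v i r a
    obtain rfl : inst = instDecidableEqFin m := Subsingleton.elim _ _
    by_cases hi : (i : ℕ) < k
    · have h1 : ∀ c : V, (fun l : Fin k => Function.update v i c ⟨l, by omega⟩) =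
          Function.update (fun l : Fin k => v ⟨l, by omega⟩) ⟨i, hi⟩ c := by
        intro c; ext l
        simp only [Function.update_apply, Fin.ext_iff]
      have h2 : ∀ c : V, (fun j : Fin (m - k) => Function.update v i c ⟨k + j, by omega⟩) =
          fun j : Fin (m - k) => v ⟨k + j, by omega⟩ := by
        intro c; ext j
        rw [Function.update_of_ne]
        intro hh; simp only [Fin.ext_iff] at hh; omega
      simp only [h1, h2, ContinuousAlternatingMap.map_update_smul]
      exact σ.toMultilinearMap.cons_smul _ _ _
    · have h1 : ∀ c : V, (fun l : Fin k => Function.update v i c ⟨l, by omega⟩) =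
          (fun l : Fin k => v ⟨l, by omega⟩) := by
        intro c; ext l
        rw [Function.update_of_ne]
        intro hh; simp only [Fin.ext_iff] at hh; omega
      have h2 : ∀ c : V, (fun j : Fin (m - k) => Function.update v i c ⟨k + j, by omega⟩) =
          Function.update (fun j : Fin (m - k) => v ⟨k + j, by omega⟩) ⟨i - k, by omega⟩ c := by
        intro c; ext j
        simp only [Function.update_apply, Fin.ext_iff]
        congr 1
        apply propext; omega
      simp only [h1, h2, Fin.cons_update, ContinuousAlternatingMap.map_update_smul]
  cont := by
    refine σ.cont.comp (continuous_pi fun j => ?_)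
    refine Fin.cases ?_ (fun j => ?_) j
    · simp only [Fin.cons_zero]
      exact K.cont.comp (continuous_pi fun i => continuous_apply _)
    · simp only [Fin.cons_succ]
      exact continuous_apply _

/-- Insertion of a `V`-valued `k`-form `K` into a form `σ` of degree `l = m - k + 1 ≥ 1`:
`(I_K σ)(v₀, …, v_{m-1}) =
  1/(k! (l-1)!) ∑ₛ sgn s · σ (K (v_{s 0}, …, v_{s (k-1)}), v_{s k}, …, v_{s (m-1)})`.
For `K = α ⊗ X` this is `α ∧ ι_X σ`. -/
def insertForm {k m : ℕ} (h : k ≤ m) (K : V [⋀^Fin k]→L[ℝ] V)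
    (σ : V [⋀^Fin (m - k + 1)]→L[ℝ] ℝ) : V [⋀^Fin m]→L[ℝ] ℝ :=
  ((k.factorial * (m - k).factorial : ℕ) : ℝ)⁻¹ •
    ContinuousMultilinearMap.alternatization (insertMultilinear h K σ)

end PointwiseAlgebra

section Manifold

variable {E : Type*} [NormedAddCommGroup E] [NormedSpace ℝ E]
variable (M : Type*) [TopologicalSpace M] [ChartedSpace E M]

/-! ### Tensor fields -/

/-- (Not necessarily smooth) vector fields. -/
abbrev VField : Type _ := (x : M) → TangentSpace 𝓘(ℝ, E) x

/-- (Not necessarily smooth) fields of endomorphisms of the tangent bundle. -/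
abbrev EndField : Type _ := (x : M) → (TangentSpace 𝓘(ℝ, E) x →L[ℝ] TangentSpace 𝓘(ℝ, E) x)

/-- (Not necessarily smooth) real differential forms of degree `k`. -/
abbrev Form (k : ℕ) : Type _ := (x : M) → TangentSpace 𝓘(ℝ, E) x [⋀^Fin k]→L[ℝ] ℝ

/-- (Not necessarily smooth) tangent-bundle-valued differential forms of degree `k`. -/
abbrev VForm (k : ℕ) : Type _ :=
  (x : M) → TangentSpace 𝓘(ℝ, E) x [⋀^Fin k]→L[ℝ] TangentSpace 𝓘(ℝ, E) x

/-- Families of forms, one in each degree. As `Form M k` is trivial for `k` larger than the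
(finite) dimension of `M`, this is the graded vector space of all forms on `M`. -/
abbrev Forms : Type _ := (k : ℕ) → Form (E := E) M k

/-- Operators on forms. -/
abbrev Operator : Type _ := Forms (E := E) M → Forms (E := E) M

variable {M}

/-- `X` is a smooth section of `TM`. -/
def IsSmoothVField [IsManifold 𝓘(ℝ, E) ∞ M] (X : VField (E := E) M) : Prop :=
  ContMDiff 𝓘(ℝ, E) (𝓘(ℝ, E).prod 𝓘(ℝ, E)) ∞
    (fun x => (⟨x, X x⟩ : Bundle.TotalSpace E (fun x : M => TangentSpace 𝓘(ℝ, E) x)))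

/-- `Φ` is a smooth section of `End(TM)`. -/
def IsSmoothEndField [IsManifold 𝓘(ℝ, E) ∞ M] (Φ : EndField (E := E) M) : Prop :=
  ContMDiff 𝓘(ℝ, E) (𝓘(ℝ, E).prod 𝓘(ℝ, E →L[ℝ] E)) ∞
    (fun x => (⟨x, Φ x⟩ : Bundle.TotalSpace (E →L[ℝ] E)
      (fun x : M => TangentSpace 𝓘(ℝ, E) x →L[ℝ] TangentSpace 𝓘(ℝ, E) x)))

/-- `σ` is a smooth section of the bundle of alternating `k`-forms on `TM`. -/
def IsSmoothForm [IsManifold 𝓘(ℝ, E) ∞ M] {k : ℕ} (σ : Form (E := E) M k) : Prop :=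
  ContMDiff 𝓘(ℝ, E) (𝓘(ℝ, E).prod 𝓘(ℝ, E [⋀^Fin k]→L[ℝ] ℝ)) ∞
    (fun x => (⟨x, σ x⟩ : Bundle.TotalSpace (E [⋀^Fin k]→L[ℝ] ℝ)
      (fun x : M => TangentSpace 𝓘(ℝ, E) x [⋀^Fin k]→L[ℝ] Bundle.Trivial M ℝ x)))

/-- `K` is a smooth section of the bundle of `TM`-valued alternating `k`-forms on `TM`. -/
def IsSmoothVForm [IsManifold 𝓘(ℝ, E) ∞ M] {k : ℕ} (K : VForm (E := E) M k) : Prop :=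
  ContMDiff 𝓘(ℝ, E) (𝓘(ℝ, E).prod 𝓘(ℝ, E [⋀^Fin k]→L[ℝ] E)) ∞
    (fun x => (⟨x, K x⟩ : Bundle.TotalSpace (E [⋀^Fin k]→L[ℝ] E)
      (fun x : M => TangentSpace 𝓘(ℝ, E) x [⋀^Fin k]→L[ℝ] TangentSpace 𝓘(ℝ, E) x)))

/-- Equality of two operators on the space of smooth forms. -/
def EqOnSmoothForms [IsManifold 𝓘(ℝ, E) ∞ M] (P Q : Operator (E := E) M) : Prop :=
  ∀ σ : Forms (E := E) M, (∀ k, IsSmoothForm (σ k)) → P σ = Q σ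

/-! ### The exterior derivative and graded commutators -/

/-- The representation of the form `σ` in the preferred chart at `x₀`, as a form on the model
space `E` (relevant on the target of the chart only). -/
def chartRep {k : ℕ} (σ : Form (E := E) M k) (x₀ : M) (y : E) : E [⋀^Fin k]→L[ℝ] ℝ :=
  (σ ((extChartAt 𝓘(ℝ, E) x₀).symm y)).compContinuousLinearMap
    (mfderiv 𝓘(ℝ, E) 𝓘(ℝ, E) (extChartAt 𝓘(ℝ, E) x₀).symm y)

/-- The exterior derivative of a `k`-form, computed in the preferred chart at each point. -/
def extD {k : ℕ} (σ : Form (E := E) M k) : Form (E := E) M (k + 1) := fun x =>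
  (extDeriv (chartRep σ x) (extChartAt 𝓘(ℝ, E) x x)).compContinuousLinearMap
    (mfderiv 𝓘(ℝ, E) 𝓘(ℝ, E) (extChartAt 𝓘(ℝ, E) x) x)

/-- The exterior derivative `d` as an operator (of degree `1`) on all forms. -/
def d : Operator (E := E) M := fun σ k =>
  match k with
  | 0 => 0
  | k + 1 => extD (σ k)

/-- The graded commutator `[P, Q] = P Q - (-1)^{pq} Q P` of operators of degrees `p` and `q`. -/
def gradedComm (p q : ℤ) (P Q : Operator (E := E) M) : Operator (E := E) M := fun σ =>
  P (Q σ) - ((Int.negOnePow (p * q) : ℤˣ) : ℤ) • Q (P σ)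

/-- `ℸ P = [d, P]` for an operator `P` of degree `p`. -/
def daleth (p : ℤ) (P : Operator (E := E) M) : Operator (E := E) M := gradedComm 1 p d P

/-- The operator `P` of degree `p` satisfies `ℸ P = 0`. -/
def IsDalethClosed [IsManifold 𝓘(ℝ, E) ∞ M] (p : ℤ) (P : Operator (E := E) M) : Prop :=
  EqOnSmoothForms (daleth p P) 0

/-! ### Frölicher-Nijenhuis calculus -/

/-- The operator `I_K` of insertion of a `TM`-valued `k`-form `K`; it has degree `k - 1`. -/
def insertion {k : ℕ} (K : VForm (E := E) M k) : Operator (E := E) M := fun σ m x =>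
  if h : k ≤ m then insertForm h (K x) (σ (m - k + 1) x) else 0

/-- The Lie derivative `L_K = [I_K, d]` along a `TM`-valued `k`-form `K`; it has degree `k`.
For `K = α ⊗ X` this is `α ∧ L_X + (-1)^k dα ∧ ι_X`. -/
def lieD {k : ℕ} (K : VForm (E := E) M k) : Operator (E := E) M :=
  gradedComm ((k : ℤ) - 1) 1 (insertion K) d

/-- `B` is the Frölicher-Nijenhuis bracket of `K` and `L`: the (unique) smooth `TM`-valued form
with `[L_K, L_L] = L_B`. -/
def IsFNBracket [IsManifold 𝓘(ℝ, E) ∞ M] {k l : ℕ} (K : VForm (E := E) M k) (L : VForm (E := E) M l)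
    (B : VForm (E := E) M (k + l)) : Prop :=
  IsSmoothVForm B ∧ EqOnSmoothForms (gradedComm k l (lieD K) (lieD L)) (lieD B)

/-- An endomorphism of `TM` as a `TM`-valued `1`-form. -/
def EndField.toVForm (Φ : EndField (E := E) M) : VForm (E := E) M 1 := fun x =>
  ContinuousAlternatingMap.ofSubsingleton ℝ _ _ (0 : Fin 1) (Φ x)

/-! ### Canonical solutions of the Maurer-Cartan equation -/

/-- `R_Φ = Id + Φ`. -/
def rOp (Φ : EndField (E := E) M) : EndField (E := E) M := fun x =>
  ContinuousLinearMap.id ℝ _ + Φ x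

/-- The endomorphism field is (pointwise, hence as a bundle map) invertible. -/
def IsInvertibleField (A : EndField (E := E) M) : Prop := ∀ x, (A x).IsInvertible

/-- The pointwise inverse of an invertible endomorphism field. -/
def invField (A : EndField (E := E) M) : EndField (E := E) M := fun x => (A x).inverse

/-- The action `(A σ)(V₁, …, V_p) = σ (A V₁, …, A V_p)` of endomorphism fields on forms. -/
def act (A : EndField (E := E) M) : Operator (E := E) M := fun σ k x =>
  (σ k x).compContinuousLinearMap (A x)

/-- `d_Φ = R_Φ d R_Φ⁻¹`. -/
def dDef (Φ : EndField (E := E) M) : Operator (E := E) M := fun σ =>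
  act (rOp Φ) (d (act (invField (rOp Φ)) σ))

/-- `e_Φ = d_Φ - d`, the canonical solution of the Maurer-Cartan equation associated to `Φ`. -/
def eSol (Φ : EndField (E := E) M) : Operator (E := E) M := fun σ => dDef Φ σ - d σ

/-- The canonical solution associated to `Φ` is of finite type `r`: `r` is the least natural
number `s` with `Φˢ [Φ, Φ] = 0`, for the Frölicher-Nijenhuis bracket. -/
def HasFiniteType [IsManifold 𝓘(ℝ, E) ∞ M] (Φ : EndField (E := E) M) (r : ℕ) : Prop :=
  ∃ B : VForm (E := E) M (1 + 1), IsFNBracket Φ.toVForm Φ.toVForm B ∧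
    IsLeast {s : ℕ | ∀ x, ((Φ x) ^ s).compContinuousAlternatingMap (B x) = 0} r

/-! ### The Nijenhuis tensor and integrability -/

/-- The vector field `Φ X`. -/
def EndField.app (Φ : EndField (E := E) M) (X : VField (E := E) M) : VField (E := E) M :=
  fun x => Φ x (X x)

/-- The Lie bracket of vector fields. -/
def bracket (X Y : VField (E := E) M) : VField (E := E) M :=
  VectorField.mlieBracket 𝓘(ℝ, E) X Y

/-- `N_Φ (X, Y) = [Φ X, Φ Y] + Φ² [X, Y] - Φ [Φ X, Y] - Φ [X, Φ Y]`. -/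
def nijenhuis (Φ : EndField (E := E) M) (X Y : VField (E := E) M) : VField (E := E) M :=
  bracket (Φ.app X) (Φ.app Y) + Φ.app (Φ.app (bracket X Y))
    - Φ.app (bracket (Φ.app X) Y) - Φ.app (bracket X (Φ.app Y))

/-- `N_Φ = 0`. -/
def NijenhuisVanishes [IsManifold 𝓘(ℝ, E) ∞ M] (Φ : EndField (E := E) M) : Prop :=
  ∀ X Y : VField (E := E) M, IsSmoothVField X → IsSmoothVField Y → nijenhuis Φ X Y = 0

/-- `J` is an almost complex structure. -/
def IsAlmostComplex [IsManifold 𝓘(ℝ, E) ∞ M] (J : EndField (E := E) M) : Prop :=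
  IsSmoothEndField J ∧ ∀ x, (J x).comp (J x) = -ContinuousLinearMap.id ℝ _

/-- Complex vector fields `Z = X + iY`, as pairs `(X, Y)` of real vector fields. -/
abbrev CField (M : Type*) [TopologicalSpace M] [ChartedSpace E M] : Type _ :=
  VField (E := E) M × VField (E := E) M

/-- The complex bilinear extension of the Lie bracket. -/
def cBracket (Z W : CField (E := E) M) : CField (E := E) M :=
  (bracket Z.1 W.1 - bracket Z.2 W.2, bracket Z.1 W.2 + bracket Z.2 W.1)

/-- `Z` is a section of `T^{0,1} = ker (J + i)`, i.e. `J Z = -i Z`. -/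
def IsType01 (J : EndField (E := E) M) (Z : CField (E := E) M) : Prop :=
  (J.app Z.1, J.app Z.2) = (Z.2, -Z.1)

/-- `J` is integrable: the subbundle `T^{0,1}` of the complexified tangent bundle is involutive,
i.e. brackets of smooth vector fields of type `(0,1)` are of type `(0,1)`. -/
def IsIntegrable [IsManifold 𝓘(ℝ, E) ∞ M] (J : EndField (E := E) M) : Prop :=
  ∀ Z W : CField (E := E) M,
    IsSmoothVField Z.1 → IsSmoothVField Z.2 → IsSmoothVField W.1 → IsSmoothVField W.2 →
    IsType01 J Z → IsType01 J W → IsType01 J (cBracket Z W)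

end Manifold

end GradedForms

end

/-! Write `R = Id + Φ`. Everything rests on the formula `e_Φ = L_Φ - I_S` with `S = R⁻¹ ∘ N_Φ`,
where `I_S` inserts the vector-valued 2-form `S`. In a chart it comes from differentiating `σ ∘ R⁻¹`
slot by slot (`extDeriv_comp_sub_extDeriv_eq`, `chartRep_eSol_sub_lieD`): the correction to `L_Φ` is
the alternatization of a bilinear map whose antisymmetric part is `-R⁻¹ N_Φ`
(`torsionMap_symm_iff`).

If `N_Φ = 0`, then `e_Φ = L_Φ` (`eSol_eq_lieD`). Since `L_Φ` anticommutes with `d`, `e_Φ` is closed,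
and the Maurer-Cartan equation `e_Φ² = -ℸ e_Φ` (`eSol_eSol`) gives `L_Φ² = 0`, that is `[Φ, Φ] = 0`.

Conversely, it is enough to find, for each covector at each point, a 1-form with that value on which
`e_Φ` and `L_Φ` agree (`nijenhuisVanishes_of_eSol_two_eq`). The two operators always agree on
functions. If `e_Φ` is closed, the differentials `df` serve; if `L_Φ² = 0`, the forms `d_Φ f` do.

For an almost complex structure, `N_J = 0` is unwound into the bracket condition on the fields `X +
iJX`. -/

namespace GradedForms

/-! ### Alternating forms on a vector space and the local formula for `e_Φ - L_Φ`. -/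

section AlternatingCalculus

open ContinuousAlternatingMap Filter
open scoped Topology

variable {E : Type*} [NormedAddCommGroup E] [NormedSpace ℝ E]
variable {G : Type*} [NormedAddCommGroup G] [NormedSpace ℝ G]

/-- Evaluation on tuples of basis vectors is injective, so it has a linear left inverse, continuous
in finite dimension. Smoothness of a form-valued map can thus be tested on fixed vectors. -/
theorem exists_clm_leftInverse_eval_basis [FiniteDimensional ℝ E] (k : ℕ) :
    ∃ (S : Type) (_ : Fintype S) (w : S → Fin k → E)
      (g : (S → ℝ) →L[ℝ] (E [⋀^Fin k]→L[ℝ] ℝ)),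
      ∀ σ : E [⋀^Fin k]→L[ℝ] ℝ, g (fun s => σ (w s)) = σ := by
  let b := Module.finBasis ℝ E
  let ev : (E [⋀^Fin k]→L[ℝ] ℝ) →ₗ[ℝ] ((Fin k → Fin (Module.finrank ℝ E)) → ℝ) :=
    { toFun := fun σ s => σ (b ∘ s)
      map_add' := fun _ _ => rfl
      map_smul' := fun _ _ => rfl }
  have hev : LinearMap.ker ev = ⊥ := by
    rw [LinearMap.ker_eq_bot]
    intro σ τ h
    apply ContinuousAlternatingMap.toAlternatingMap_injective
    apply AlternatingMap.coe_multilinearMap_injective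
    exact Module.Basis.ext_multilinear (fun _ => b) fun s => congrFun h s
  obtain ⟨g, hg⟩ := ev.exists_leftInverse_of_injective hev
  exact ⟨_, inferInstance, fun s => b ∘ s, LinearMap.toContinuousLinearMap g,
    fun σ => LinearMap.congr_fun hg σ⟩

theorem contDiffAt_alternating_of_forall_apply [FiniteDimensional ℝ E] {k : ℕ} {n : WithTop ℕ∞}
    {f : G → E [⋀^Fin k]→L[ℝ] ℝ} {x : G} (h : ∀ v, ContDiffAt ℝ n (fun y => f y v) x) :
    ContDiffAt ℝ n f x := by
  obtain ⟨S, _, w, g, hg⟩ := exists_clm_leftInverse_eval_basis (E := E) k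
  have : f = fun y => g (fun s => f y (w s)) := funext fun y => (hg _).symm
  rw [this]
  exact g.contDiff.contDiffAt.comp x (contDiffAt_pi.2 fun s => h _)

theorem _root_.ContDiffAt.alternating_apply {k : ℕ} {n : WithTop ℕ∞}
    {f : G → E [⋀^Fin k]→L[ℝ] ℝ} {v : Fin k → G → E} {x : G} (hf : ContDiffAt ℝ n f x)
    (hv : ∀ i, ContDiffAt ℝ n (v i) x) : ContDiffAt ℝ n (fun y => f y (fun i => v i y)) x := by
  induction k with
  | zero =>
    have h : (fun y => f y (fun i => v i y)) =
        fun y => ContinuousAlternatingMap.apply ℝ E ℝ (0 : Fin 0 → E) (f y) := by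
      ext y
      exact congrArg (f y) (Subsingleton.elim _ _)
    rw [h]
    exact (ContinuousLinearMap.contDiff _).contDiffAt.comp x hf
  | succ k ih =>
    -- Currying the first argument reduces the degree by one and leaves an application of a
    -- continuous linear map.
    have h : (fun y => f y (fun i => v i y)) =
        fun y => ((f y).curryLeft (v 0 y)) (fun i => v i.succ y) := by
      ext y
      rw [curryLeft_apply_apply]
      congr 1
      ext i
      refine Fin.cases rfl (fun _ => rfl) i
    rw [h]
    refine ih (ContDiffAt.clm_apply ?_ (hv 0)) fun i => hv i.succ
    exact (LinearIsometry.contDiff (F := E →L[ℝ] E [⋀^Fin k]→L[ℝ] ℝ)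
      curryLeftLI).contDiffAt.comp x hf

theorem _root_.ContDiffAt.alternating_comp [FiniteDimensional ℝ E] {k : ℕ} {n : WithTop ℕ∞}
    {f : G → E [⋀^Fin k]→L[ℝ] ℝ} {A : G → E →L[ℝ] E} {x : G} (hf : ContDiffAt ℝ n f x)
    (hA : ContDiffAt ℝ n A x) :
    ContDiffAt ℝ n (fun y => (f y).compContinuousLinearMap (A y)) x :=
  contDiffAt_alternating_of_forall_apply fun _ =>
    hf.alternating_apply fun _ => hA.clm_apply contDiffAt_const

/-- The insertion of an endomorphism into an alternating form. -/
noncomputable def insertEnd {k : ℕ} (σ : E [⋀^Fin k]→L[ℝ] ℝ) (K : E →L[ℝ] E) :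
    E [⋀^Fin k]→L[ℝ] ℝ :=
  fderivCompContinuousLinearMapCLM ℝ (ContinuousLinearMap.id ℝ E) σ K

theorem insertEnd_apply {k : ℕ} (σ : E [⋀^Fin k]→L[ℝ] ℝ) (K : E →L[ℝ] E) (v : Fin k → E) :
    insertEnd σ K v = ∑ i, σ (Function.update v i (K (v i))) := by
  simp only [insertEnd, fderivCompContinuousLinearMapCLM_apply, fderivCompContinuousLinearMap_apply]
  refine Finset.sum_congr rfl fun i _ => congrArg σ ?_
  ext j
  rcases eq_or_ne j i with rfl | h <;> simp [*]

theorem _root_.ContDiffAt.insertEnd {k : ℕ} {n : WithTop ℕ∞}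
    {f : G → E [⋀^Fin k]→L[ℝ] ℝ} {A : G → E →L[ℝ] E} {x : G} (hf : ContDiffAt ℝ n f x)
    (hA : ContDiffAt ℝ n A x) : ContDiffAt ℝ n (fun y => insertEnd (f y) (A y)) x :=
  ((ContinuousLinearMap.contDiff _).contDiffAt.comp x hf).clm_apply hA

theorem _root_.ContDiffAt.extDeriv {k : ℕ} {f : E → E [⋀^Fin k]→L[ℝ] ℝ} {x : E}
    (hf : ContDiffAt ℝ ∞ f x) : ContDiffAt ℝ ∞ (extDeriv f) x :=
  (alternatizeUncurryFinCLM ℝ E ℝ).contDiff.contDiffAt.comp x (hf.fderiv_right le_rfl)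

theorem fderiv_insertEnd_apply {k : ℕ} {f : G → E [⋀^Fin k]→L[ℝ] ℝ} {A : G → E →L[ℝ] E} {x : G}
    (hf : DifferentiableAt ℝ f x) (hA : DifferentiableAt ℝ A x) (u : G) :
    fderiv ℝ (fun y => insertEnd (f y) (A y)) x u =
      insertEnd (fderiv ℝ f x u) (A x) + insertEnd (f x) (fderiv ℝ A x u) := by
  have h := ((fderivCompContinuousLinearMapCLM ℝ (ι := Fin k)
    (ContinuousLinearMap.id ℝ E)).hasFDerivAt_of_bilinear hf.hasFDerivAt hA.hasFDerivAt).fderiv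
  unfold insertEnd
  rw [h]
  exact add_comm _ _

theorem extDeriv_zero_apply {k : ℕ} (x : E) :
    extDeriv (fun _ => (0 : E [⋀^Fin k]→L[ℝ] ℝ)) x = 0 := by
  ext v
  simp [extDeriv, alternatizeUncurryFin_apply]

/-- The difference between `e_Φ` and `L_Φ` is the insertion of this vector-valued bilinear map. -/
noncomputable def torsionMap (Φ A : E → E →L[ℝ] E) (x : E) : E →L[ℝ] E →L[ℝ] E :=
  fderiv ℝ Φ x - ((ContinuousLinearMap.compL ℝ E E E (A x)).comp
    ((fderiv ℝ Φ x).comp (ContinuousLinearMap.id ℝ E + Φ x)))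

theorem torsionMap_apply (Φ A : E → E →L[ℝ] E) (x u v : E) :
    torsionMap Φ A x u v = fderiv ℝ Φ x u v - A x (fderiv ℝ Φ x (u + Φ x u) v) := by
  simp [torsionMap]

/-- Differentiate the identity `A y (v + Φ y v) = v`, whose right side is constant in `y`. -/
theorem fderiv_leftInverse {Φ A : E → E →L[ℝ] E} {x : E}
    (hΦ : DifferentiableAt ℝ Φ x) (hA : DifferentiableAt ℝ A x)
    (h : ∀ᶠ y in 𝓝 x, (A y).comp (ContinuousLinearMap.id ℝ E + Φ y) = ContinuousLinearMap.id ℝ E)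
    (u v : E) : fderiv ℝ A x u (v + Φ x v) = - A x (fderiv ℝ Φ x u v) := by
  have h1 : HasFDerivAt (fun y => A y (v + Φ y v)) (0 : E →L[ℝ] E) x := by
    refine (hasFDerivAt_const v x).congr_of_eventuallyEq ?_
    filter_upwards [h] with y hy
    exact DFunLike.congr_fun hy v
  have h2 := hA.hasFDerivAt.clm_apply
    ((hasFDerivAt_const v x).add (hΦ.hasFDerivAt.clm_apply (hasFDerivAt_const v x)))
  have h3 := DFunLike.congr_fun (h1.unique h2) u
  simp at h3
  rw [eq_neg_iff_add_eq_zero, add_comm, map_add]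
  exact h3.symm

theorem sum_insertEnd_alternatize {k : ℕ} (D : E →L[ℝ] E [⋀^Fin k]→L[ℝ] ℝ) (K : E →L[ℝ] E)
    (v : Fin (k + 1) → E) :
    insertEnd (alternatizeUncurryFin D) K v =
      ∑ i : Fin (k + 1), (-1 : ℤ) ^ (i : ℕ) • (D (K (v i)) (i.removeNth v)
        + insertEnd (D (v i)) K (i.removeNth v)) := by
  simp only [insertEnd_apply, alternatizeUncurryFin_apply]
  rw [Finset.sum_comm]
  refine Finset.sum_congr rfl fun i _ => ?_
  -- The slot receiving `K` is either the slot `i` of differentiation or one of the others, indexed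
  -- by `i.succAbove`.
  rw [Fin.sum_univ_succAbove _ i, smul_add, Finset.smul_sum]
  congr 1
  · rw [Function.update_self, Fin.removeNth_update]
  · refine Finset.sum_congr rfl fun j _ => ?_
    rw [Function.update_of_ne (Fin.succAbove_ne i j).symm, Fin.removeNth_update_succAbove]
    rfl

theorem insertEnd_sub_right {k : ℕ} (σ : E [⋀^Fin k]→L[ℝ] ℝ) (K L : E →L[ℝ] E) :
    insertEnd σ (K - L) = insertEnd σ K - insertEnd σ L := map_sub _ _ _

theorem fderivCompContinuousLinearMap_apply_comp {k : ℕ} (σ : E [⋀^Fin k]→L[ℝ] ℝ)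
    {A B : E →L[ℝ] E} (h : A.comp B = ContinuousLinearMap.id ℝ E) (K : E →L[ℝ] E)
    (v : Fin k → E) :
    σ.fderivCompContinuousLinearMap A K (fun i => B (v i)) = insertEnd σ (K.comp B) v := by
  simp only [insertEnd_apply, fderivCompContinuousLinearMap_apply]
  refine Finset.sum_congr rfl fun i _ => congrArg σ ?_
  have h' : ∀ x, A (B x) = x := DFunLike.congr_fun h
  ext j
  rcases eq_or_ne j i with rfl | h <;> simp [*]

/-- All terms are alternating sums over the slot `i` of differentiation, and they match for each `i`
separately. In the direction `v i + Φ (v i)`, the derivative of `s` has `A` cancelled by `Id + Φ`,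
while the derivative of `A` contributes an insertion of `torsionMap` minus the derivative of `Φ`.
That last term is the one produced by differentiating `insertEnd (s y) (Φ y)`. -/
theorem extDeriv_comp_sub_extDeriv_eq {k : ℕ} {s : E → E [⋀^Fin k]→L[ℝ] ℝ} {Φ A : E → E →L[ℝ] E}
    {x : E} (hs : DifferentiableAt ℝ s x) (hΦ : DifferentiableAt ℝ Φ x)
    (hA : DifferentiableAt ℝ A x)
    (h : ∀ᶠ y in 𝓝 x, (A y).comp (ContinuousLinearMap.id ℝ E + Φ y) = ContinuousLinearMap.id ℝ E) :
    (extDeriv (fun y => (s y).compContinuousLinearMap (A y)) x).compContinuousLinearMap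
        (ContinuousLinearMap.id ℝ E + Φ x) - extDeriv s x =
      insertEnd (extDeriv s x) (Φ x) - extDeriv (fun y => insertEnd (s y) (Φ y)) x +
        alternatizeUncurryFin ((s x).fderivCompContinuousLinearMap (ContinuousLinearMap.id ℝ E) ∘L
          torsionMap Φ A x) := by
  have hAx := h.self_of_nhds
  have hAx' : ∀ v, A x (v + Φ x v) = v := DFunLike.congr_fun hAx
  ext v
  simp only [ContinuousAlternatingMap.sub_apply,
    ContinuousAlternatingMap.add_apply, compContinuousLinearMap_apply]
  rw [extDeriv, extDeriv, extDeriv, sum_insertEnd_alternatize]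
  simp only [alternatizeUncurryFin_apply, ← Finset.sum_sub_distrib, ← Finset.sum_add_distrib,
    ← smul_sub, ← smul_add]
  refine Finset.sum_congr rfl fun i _ => congrArg _ ?_
  rw [fderiv_insertEnd_apply hs hΦ, fderiv_continuousAlternatingMapCompContinuousLinearMap hs hA]
  have h1 : (fderiv ℝ A x (v i + Φ x (v i))).comp (ContinuousLinearMap.id ℝ E + Φ x) =
      torsionMap Φ A x (v i) - fderiv ℝ Φ x (v i) := by
    ext w
    simp only [torsionMap_apply, ContinuousLinearMap.comp_apply, _root_.sub_apply,
      _root_.add_apply, ContinuousLinearMap.id_apply]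
    rw [fderiv_leftInverse hΦ hA h]
    abel
  have h2 := fderivCompContinuousLinearMap_apply_comp (s x) hAx
    (fderiv ℝ A x (v i + Φ x (v i))) (i.removeNth v)
  rw [h1, insertEnd_sub_right] at h2
  have h3 : i.removeNth (⇑(ContinuousLinearMap.id ℝ E + Φ x) ∘ v) =
    fun j => (ContinuousLinearMap.id ℝ E + Φ x) (i.removeNth v j) := rfl
  have h4 : (fderiv ℝ s x (v i + Φ x (v i))).compContinuousLinearMap (A x)
      (fun j => (ContinuousLinearMap.id ℝ E + Φ x) (i.removeNth v j)) =
      fderiv ℝ s x (v i) (i.removeNth v) + fderiv ℝ s x (Φ x (v i)) (i.removeNth v) := by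
    rw [map_add]
    simp only [compContinuousLinearMap_apply, ContinuousAlternatingMap.add_apply]
    congr 2 <;> ext j <;> exact hAx' _
  rw [h3]
  simp only [_root_.add_apply, ContinuousAlternatingMap.add_apply,
    ContinuousAlternatingMap.sub_apply, ContinuousLinearMap.comp_apply, Function.comp_apply,
    ContinuousLinearMap.id_apply, compContinuousLinearMapCLM_apply] at h2 h4 ⊢
  rw [h2, h4, ← fderivCompContinuousLinearMapCLM_apply]
  simp only [insertEnd]
  ring

theorem alternatize_torsion_eq_zero {k : ℕ} {s : E [⋀^Fin k]→L[ℝ] ℝ} {Φ A : E → E →L[ℝ] E}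
    {x : E} (h : ∀ u v, torsionMap Φ A x u v = torsionMap Φ A x v u) :
    alternatizeUncurryFin (s.fderivCompContinuousLinearMap (ContinuousLinearMap.id ℝ E) ∘L
      torsionMap Φ A x) = 0 :=
  alternatizeUncurryFin_fderivCompContinuousLinearMap_eq_zero _ _ h

/-- On 1-forms the correction term sees exactly the antisymmetric part of `T`; this is what the
converse directions exploit. -/
theorem alternatize_torsion_one {s : E [⋀^Fin 1]→L[ℝ] ℝ} (T : E →L[ℝ] E →L[ℝ] E) (u v : E) :
    alternatizeUncurryFin (s.fderivCompContinuousLinearMap (ContinuousLinearMap.id ℝ E) ∘L T)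
      ![u, v] = s ![T u v - T v u] := by
  obtain ⟨l, rfl⟩ := (ofSubsingleton ℝ E ℝ (0 : Fin 1)).surjective s
  simp [alternatizeUncurryFin_apply, Fin.sum_univ_two, sub_eq_add_neg, Fin.removeNth]

/-- The Nijenhuis tensor of an endomorphism field of a vector space. -/
noncomputable def nijenhuisAt (Φ : E → E →L[ℝ] E) (x u v : E) : E :=
  fderiv ℝ Φ x (Φ x u) v - fderiv ℝ Φ x (Φ x v) u + Φ x (fderiv ℝ Φ x v u)
    - Φ x (fderiv ℝ Φ x u v)

theorem torsionMap_symm_iff {Φ A : E → E →L[ℝ] E} {x : E}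
    (hl : (A x).comp (ContinuousLinearMap.id ℝ E + Φ x) = ContinuousLinearMap.id ℝ E)
    (hr : (ContinuousLinearMap.id ℝ E + Φ x).comp (A x) = ContinuousLinearMap.id ℝ E) (u v : E) :
    torsionMap Φ A x u v = torsionMap Φ A x v u ↔ nijenhuisAt Φ x u v = 0 := by
  have hl' : ∀ w, A x (w + Φ x w) = w := DFunLike.congr_fun hl
  have hr' : ∀ w, A x w + Φ x (A x w) = w := DFunLike.congr_fun hr
  -- Writing `DΦ(u) v` as `A (DΦ(u) v + Φ (DΦ(u) v))` lets `A` be factored out of the whole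
  -- expression. The equivalence then follows because `A` is injective.
  have key : torsionMap Φ A x u v - torsionMap Φ A x v u = - A x (nijenhuisAt Φ x u v) := by
    rw [torsionMap_apply, torsionMap_apply, nijenhuisAt]
    nth_rw 1 [← hl' (fderiv ℝ Φ x u v)]
    nth_rw 1 [← hl' (fderiv ℝ Φ x v u)]
    simp only [_root_.map_add, _root_.map_sub, _root_.add_apply]
    abel
  rw [← sub_eq_zero, key, neg_eq_zero]
  refine ⟨fun h0 => ?_, fun h0 => by rw [h0, _root_.map_zero]⟩
  rw [← hr' (nijenhuisAt Φ x u v), h0, _root_.map_zero, add_zero]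

/-- The derivatives of `X` and `Y` cancel, leaving only derivatives of `Φ`: the Nijenhuis expression
is tensorial. -/
theorem nijenhuisAt_eq_lieBracket {Φ : E → E →L[ℝ] E} {X Y : E → E} {x : E}
    (hΦ : DifferentiableAt ℝ Φ x) (hX : DifferentiableAt ℝ X x) (hY : DifferentiableAt ℝ Y x) :
    VectorField.lieBracket ℝ (fun y => Φ y (X y)) (fun y => Φ y (Y y)) x
      + Φ x (Φ x (VectorField.lieBracket ℝ X Y x))
      - Φ x (VectorField.lieBracket ℝ (fun y => Φ y (X y)) Y x)
      - Φ x (VectorField.lieBracket ℝ X (fun y => Φ y (Y y)) x) = nijenhuisAt Φ x (X x) (Y x) := by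
  have h : ∀ {Z : E → E}, DifferentiableAt ℝ Z x → ∀ w, fderiv ℝ (fun y => Φ y (Z y)) x w =
      Φ x (fderiv ℝ Z x w) + fderiv ℝ Φ x w (Z x) := fun hZ w => by
    rw [(hΦ.hasFDerivAt.clm_apply hZ.hasFDerivAt).fderiv]
    simp
  simp only [VectorField.lieBracket, h hX, h hY, nijenhuisAt, map_add, map_sub]
  abel

end AlternatingCalculus
-- Passage to charts, and chart independence of the exterior derivative.
section Charts

open Filter
open scoped Topology

variable {E : Type*} [NormedAddCommGroup E] [NormedSpace ℝ E]
variable {M : Type*} [TopologicalSpace M] [ChartedSpace E M]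

/-- The derivative of the preferred chart at `x₀`, at the point with coordinates `y`. -/
noncomputable def chartD (x₀ : M) (y : E) :
    TangentSpace 𝓘(ℝ, E) ((extChartAt 𝓘(ℝ, E) x₀).symm y) →L[ℝ] E :=
  mfderiv 𝓘(ℝ, E) 𝓘(ℝ, E) (extChartAt 𝓘(ℝ, E) x₀) ((extChartAt 𝓘(ℝ, E) x₀).symm y)

/-- The derivative of the inverse of the preferred chart at `x₀`. -/
noncomputable def chartSymmD (x₀ : M) (y : E) :
    E →L[ℝ] TangentSpace 𝓘(ℝ, E) ((extChartAt 𝓘(ℝ, E) x₀).symm y) :=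
  mfderiv 𝓘(ℝ, E) 𝓘(ℝ, E) (extChartAt 𝓘(ℝ, E) x₀).symm y

/-- An endomorphism field in the preferred chart at `x₀`. -/
noncomputable def endRep (A : EndField (E := E) M) (x₀ : M) (y : E) : E →L[ℝ] E :=
  (chartD x₀ y).comp ((A ((extChartAt 𝓘(ℝ, E) x₀).symm y)).comp (chartSymmD x₀ y))

/-- A vector field in the preferred chart at `x₀`. -/
noncomputable def vecRep (X : VField (E := E) M) (x₀ : M) (y : E) : E :=
  chartD x₀ y (X ((extChartAt 𝓘(ℝ, E) x₀).symm y))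

theorem chartRep_eq {k : ℕ} (σ : Form (E := E) M k) (x₀ : M) (y : E) :
    chartRep σ x₀ y =
      (σ ((extChartAt 𝓘(ℝ, E) x₀).symm y)).compContinuousLinearMap (chartSymmD x₀ y) := rfl

variable [IsManifold 𝓘(ℝ, E) ∞ M]

theorem chartD_comp_chartSymmD (x₀ : M) {y : E} (hy : y ∈ (extChartAt 𝓘(ℝ, E) x₀).target) :
    (chartD x₀ y).comp (chartSymmD x₀ y) = ContinuousLinearMap.id ℝ E := by
  have : IsManifold 𝓘(ℝ, E) 1 M := IsManifold.of_le (n := ∞) (by norm_cast)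
  have h := mfderiv_extChartAt_comp_mfderivWithin_extChartAt_symm (I := 𝓘(ℝ, E)) hy
  rw [modelWithCornersSelf_coe, Set.range_id, mfderivWithin_univ] at h
  exact h

theorem chartSymmD_comp_chartD (x₀ : M) {y : E} (hy : y ∈ (extChartAt 𝓘(ℝ, E) x₀).target) :
    (chartSymmD x₀ y).comp (chartD x₀ y) = ContinuousLinearMap.id ℝ _ := by
  have : IsManifold 𝓘(ℝ, E) 1 M := IsManifold.of_le (n := ∞) (by norm_cast)
  have h := mfderivWithin_extChartAt_symm_comp_mfderiv_extChartAt (I := 𝓘(ℝ, E)) hy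
  rw [modelWithCornersSelf_coe, Set.range_id, mfderivWithin_univ] at h
  exact h

theorem chartD_chartSymmD (x₀ : M) {y : E} (hy : y ∈ (extChartAt 𝓘(ℝ, E) x₀).target) (v : E) :
    chartD x₀ y (chartSymmD x₀ y v) = v :=
  DFunLike.congr_fun (chartD_comp_chartSymmD x₀ hy) v

theorem chartSymmD_chartD (x₀ : M) {y : E} (hy : y ∈ (extChartAt 𝓘(ℝ, E) x₀).target)
    (v : TangentSpace 𝓘(ℝ, E) ((extChartAt 𝓘(ℝ, E) x₀).symm y)) :
    chartSymmD x₀ y (chartD x₀ y v) = v :=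
  DFunLike.congr_fun (chartSymmD_comp_chartD x₀ hy) v

/-- Transfers smoothness between a bundle section read in the trivialization at `x` and its
coordinate representative. -/
theorem contMDiffAt_comp_extChartAt_iff {F : Type*} [NormedAddCommGroup F] [NormedSpace ℝ F]
    {f : E → F} {g : M → F} (x : M)
    (h : ∀ z ∈ (extChartAt 𝓘(ℝ, E) x).source, g z = f (extChartAt 𝓘(ℝ, E) x z)) :
    ContMDiffAt 𝓘(ℝ, E) 𝓘(ℝ, F) ∞ g x ↔ ContDiffAt ℝ ∞ f (extChartAt 𝓘(ℝ, E) x x) := by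
  rw [← contMDiffAt_iff_contDiffAt]
  constructor
  · intro hg
    have h1 : ContMDiffAt 𝓘(ℝ, E) 𝓘(ℝ, E) ∞ (extChartAt 𝓘(ℝ, E) x).symm
        (extChartAt 𝓘(ℝ, E) x x) :=
      (contMDiffOn_extChartAt_symm x).contMDiffAt (extChartAt_target_mem_nhds x)
    have h2 : ContMDiffAt 𝓘(ℝ, E) 𝓘(ℝ, F) ∞ g
        ((extChartAt 𝓘(ℝ, E) x).symm (extChartAt 𝓘(ℝ, E) x x)) := by
      rwa [extChartAt_to_inv]
    refine (h2.comp _ h1).congr_of_eventuallyEq ?_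
    filter_upwards [extChartAt_target_mem_nhds x] with y hy
    rw [Function.comp_apply, h _ ((extChartAt 𝓘(ℝ, E) x).map_target hy),
      (extChartAt 𝓘(ℝ, E) x).right_inv hy]
  · intro hf
    refine (hf.comp x contMDiffAt_extChartAt).congr_of_eventuallyEq ?_
    filter_upwards [extChartAt_source_mem_nhds (I := 𝓘(ℝ, E)) x] with z hz using h z hz

theorem continuousLinearMapAt_eq_chartD {x₀ x : M} (hx : x ∈ (extChartAt 𝓘(ℝ, E) x₀).source) :
    (trivializationAt E (TangentSpace 𝓘(ℝ, E)) x₀).continuousLinearMapAt ℝ x =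
      mfderiv 𝓘(ℝ, E) 𝓘(ℝ, E) (extChartAt 𝓘(ℝ, E) x₀) x := by
  have : IsManifold 𝓘(ℝ, E) 1 M := IsManifold.of_le (n := ∞) (by norm_cast)
  rw [extChartAt_source] at hx
  exact TangentBundle.continuousLinearMapAt_trivializationAt hx

theorem symmL_eq_chartSymmD {x₀ x : M} (hx : x ∈ (extChartAt 𝓘(ℝ, E) x₀).source) :
    (trivializationAt E (TangentSpace 𝓘(ℝ, E)) x₀).symmL ℝ x =
      mfderiv 𝓘(ℝ, E) 𝓘(ℝ, E) (extChartAt 𝓘(ℝ, E) x₀).symm (extChartAt 𝓘(ℝ, E) x₀ x) := by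
  have : IsManifold 𝓘(ℝ, E) 1 M := IsManifold.of_le (n := ∞) (by norm_cast)
  rw [extChartAt_source] at hx
  have h := TangentBundle.symmL_trivializationAt (I := 𝓘(ℝ, E)) hx
  rw [modelWithCornersSelf_coe, Set.range_id, mfderivWithin_univ] at h
  exact h

theorem isSmoothForm_iff {k : ℕ} {σ : Form (E := E) M k} :
    IsSmoothForm σ ↔ ∀ x, ContDiffAt ℝ ∞ (chartRep σ x) (extChartAt 𝓘(ℝ, E) x x) := by
  refine forall_congr' fun x => ?_
  refine (Bundle.contMDiffAt_section x).trans (contMDiffAt_comp_extChartAt_iff x fun z hz => ?_)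
  rw [FiberBundle.trivializationAt_continuousAlternatingMap_apply]
  simp only [ContinuousAlternatingMap.inCoordinates]
  rw [symmL_eq_chartSymmD hz]
  ext v
  simp only [chartRep]
  rw [(extChartAt 𝓘(ℝ, E) x).left_inv hz]
  simp
  rfl

theorem IsSmoothEndField.contDiffAt {A : EndField (E := E) M} (hA : IsSmoothEndField A) (x : M) :
    ContDiffAt ℝ ∞ (endRep A x) (extChartAt 𝓘(ℝ, E) x x) := by
  refine (contMDiffAt_comp_extChartAt_iff x fun z hz => ?_).1 ((Bundle.contMDiffAt_section x).1
    (hA x))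
  rw [hom_trivializationAt_apply]
  simp only [ContinuousLinearMap.inCoordinates]
  rw [symmL_eq_chartSymmD hz, continuousLinearMapAt_eq_chartD hz]
  simp only [endRep, chartD, chartSymmD]
  rw [(extChartAt 𝓘(ℝ, E) x).left_inv hz]

theorem IsSmoothVField.contDiffAt {X : VField (E := E) M} (hX : IsSmoothVField X) (x : M) :
    ContDiffAt ℝ ∞ (vecRep X x) (extChartAt 𝓘(ℝ, E) x x) := by
  refine (contMDiffAt_comp_extChartAt_iff x fun z hz => ?_).1 ((Bundle.contMDiffAt_section x).1
    (hX x))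
  have h : ((trivializationAt E (TangentSpace 𝓘(ℝ, E)) x) ⟨z, X z⟩).2 =
      (trivializationAt E (TangentSpace 𝓘(ℝ, E)) x).continuousLinearMapAt ℝ z (X z) := by
    rw [Bundle.Trivialization.continuousLinearMapAt_apply_of_mem]
    rw [extChartAt_source] at hz
    simpa using hz
  rw [h, continuousLinearMapAt_eq_chartD hz]
  simp only [vecRep, chartD]
  rw [(extChartAt 𝓘(ℝ, E) x).left_inv hz]

theorem contMDiffAt_extChartAt_symm (x₀ : M) {y : E}
    (hy : y ∈ (extChartAt 𝓘(ℝ, E) x₀).target) :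
    ContMDiffAt 𝓘(ℝ, E) 𝓘(ℝ, E) ∞ (extChartAt 𝓘(ℝ, E) x₀).symm y :=
  (contMDiffOn_extChartAt_symm x₀).contMDiffAt ((isOpen_extChartAt_target x₀).mem_nhds hy)

theorem contMDiffAt_extChartAt_of_mem {x₀ x : M} (hx : x ∈ (extChartAt 𝓘(ℝ, E) x₀).source) :
    ContMDiffAt 𝓘(ℝ, E) 𝓘(ℝ, E) ∞ (extChartAt 𝓘(ℝ, E) x₀) x := by
  rw [extChartAt_source] at hx
  exact contMDiffAt_extChartAt' hx

omit [IsManifold 𝓘(ℝ, E) ∞ M] in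
-- Values of a form at propositionally equal base points lie in different types; both are coerced to
-- functions on `Fin k → E` so that they can be compared.
theorem Form.apply_congr {k : ℕ} (σ : Form (E := E) M k) {p q : M} (h : p = q)
    {u w : Fin k → E} (huw : u = w) :
    (σ p : (Fin k → E) → ℝ) u = (σ q : (Fin k → E) → ℝ) w := by
  subst h huw
  rfl

theorem chartSymmD_comp_fderiv {x₀ x : M} {z : E} (hz : z ∈ (extChartAt 𝓘(ℝ, E) x₀).target)
    (hzx : (extChartAt 𝓘(ℝ, E) x₀).symm z ∈ (extChartAt 𝓘(ℝ, E) x).source) (v : E) :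
    (chartSymmD x (extChartAt 𝓘(ℝ, E) x ((extChartAt 𝓘(ℝ, E) x₀).symm z))
      (fderiv ℝ (extChartAt 𝓘(ℝ, E) x ∘ (extChartAt 𝓘(ℝ, E) x₀).symm) z v) : E) =
      (chartSymmD x₀ z v : E) := by
  have h1 : MDifferentiableAt 𝓘(ℝ, E) 𝓘(ℝ, E) (extChartAt 𝓘(ℝ, E) x₀).symm z :=
    (contMDiffAt_extChartAt_symm x₀ hz).mdifferentiableAt (by simp)
  have h2 : MDifferentiableAt 𝓘(ℝ, E) 𝓘(ℝ, E) (extChartAt 𝓘(ℝ, E) x)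
      ((extChartAt 𝓘(ℝ, E) x₀).symm z) :=
    (contMDiffAt_extChartAt_of_mem hzx).mdifferentiableAt (by simp)
  have h3 : MDifferentiableAt 𝓘(ℝ, E) 𝓘(ℝ, E) (extChartAt 𝓘(ℝ, E) x).symm
      (extChartAt 𝓘(ℝ, E) x ((extChartAt 𝓘(ℝ, E) x₀).symm z)) :=
    (contMDiffAt_extChartAt_symm x ((extChartAt 𝓘(ℝ, E) x).map_source hzx)).mdifferentiableAt
      (by simp)
  have h4 := mfderiv_comp (I := 𝓘(ℝ, E)) (I' := 𝓘(ℝ, E)) (I'' := 𝓘(ℝ, E)) z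
    (g := (extChartAt 𝓘(ℝ, E) x).symm)
    (f := extChartAt 𝓘(ℝ, E) x ∘ (extChartAt 𝓘(ℝ, E) x₀).symm) h3 (h2.comp z h1)
  -- The transition map followed by the inverse chart at `x` is the inverse chart at `x₀`; the chain
  -- rule does the rest.
  have h5 : (extChartAt 𝓘(ℝ, E) x).symm ∘ (extChartAt 𝓘(ℝ, E) x ∘ (extChartAt 𝓘(ℝ, E) x₀).symm)
      =ᶠ[𝓝 z] (extChartAt 𝓘(ℝ, E) x₀).symm := by
    filter_upwards [(contMDiffAt_extChartAt_symm x₀ hz).continuousAt.eventually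
      ((isOpen_extChartAt_source x).mem_nhds hzx)] with w hw
    exact (extChartAt 𝓘(ℝ, E) x).left_inv hw
  rw [h5.mfderiv_eq, mfderiv_eq_fderiv] at h4
  exact (DFunLike.congr_fun h4 v).symm

theorem fderiv_transition_eq {x₀ x : M} {z : E} (hz : z ∈ (extChartAt 𝓘(ℝ, E) x₀).target)
    (hzx : (extChartAt 𝓘(ℝ, E) x₀).symm z ∈ (extChartAt 𝓘(ℝ, E) x).source) (v : E) :
    fderiv ℝ (extChartAt 𝓘(ℝ, E) x ∘ (extChartAt 𝓘(ℝ, E) x₀).symm) z v =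
      (mfderiv 𝓘(ℝ, E) 𝓘(ℝ, E) (extChartAt 𝓘(ℝ, E) x) ((extChartAt 𝓘(ℝ, E) x₀).symm z)
        (chartSymmD x₀ z v) : E) := by
  have h1 : MDifferentiableAt 𝓘(ℝ, E) 𝓘(ℝ, E) (extChartAt 𝓘(ℝ, E) x₀).symm z :=
    (contMDiffAt_extChartAt_symm x₀ hz).mdifferentiableAt (by simp)
  have h2 : MDifferentiableAt 𝓘(ℝ, E) 𝓘(ℝ, E) (extChartAt 𝓘(ℝ, E) x)
      ((extChartAt 𝓘(ℝ, E) x₀).symm z) :=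
    (contMDiffAt_extChartAt_of_mem hzx).mdifferentiableAt (by simp)
  have h3 := mfderiv_comp (I := 𝓘(ℝ, E)) (I' := 𝓘(ℝ, E)) (I'' := 𝓘(ℝ, E)) z
    (g := extChartAt 𝓘(ℝ, E) x) (f := (extChartAt 𝓘(ℝ, E) x₀).symm) h2 h1
  rw [mfderiv_eq_fderiv] at h3
  exact DFunLike.congr_fun h3 v

/-- `extD` uses at each point the preferred chart of that very point, so its representative in the
chart at `x₀` mixes many charts. Naturality of `extDeriv` under the transition map `τ` reconciles
them. -/
theorem chartRep_extD {k : ℕ} {σ : Form (E := E) M k} (hσ : IsSmoothForm σ) (x₀ : M) {y : E}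
    (hy : y ∈ (extChartAt 𝓘(ℝ, E) x₀).target) :
    chartRep (extD σ) x₀ y = extDeriv (chartRep σ x₀) y := by
  set x := (extChartAt 𝓘(ℝ, E) x₀).symm y with hx
  let τ : E → E := extChartAt 𝓘(ℝ, E) x ∘ (extChartAt 𝓘(ℝ, E) x₀).symm
  have hxx : (extChartAt 𝓘(ℝ, E) x₀).symm y ∈ (extChartAt 𝓘(ℝ, E) x).source :=
    mem_extChartAt_source x
  have hτ : ContDiffAt ℝ ∞ τ y := by
    rw [← contMDiffAt_iff_contDiffAt]
    exact ContMDiffAt.comp y (contMDiffAt_extChartAt (x := x)) (contMDiffAt_extChartAt_symm x₀ hy)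
  have hτy : τ y = extChartAt 𝓘(ℝ, E) x x := rfl
  have hpull : chartRep σ x₀ =ᶠ[𝓝 y]
      fun z => (chartRep σ x (τ z)).compContinuousLinearMap (fderiv ℝ τ z) := by
    filter_upwards [(isOpen_extChartAt_target x₀).mem_nhds hy,
      (contMDiffAt_extChartAt_symm x₀ hy).continuousAt.eventually
        (extChartAt_source_mem_nhds (I := 𝓘(ℝ, E)) x)]
      with z hz hzx
    ext v
    exact Form.apply_congr σ ((extChartAt 𝓘(ℝ, E) x).left_inv hzx).symm
      (funext fun i => (chartSymmD_comp_fderiv hz hzx (v i)).symm)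
  rw [hpull.extDeriv_eq, extDeriv_pullback (r := ∞) (by
    rw [hτy]; exact ((isSmoothForm_iff.1 hσ) x).differentiableAt (by simp)) hτ (by simp; norm_cast)]
  ext v
  exact congrArg (extDeriv (chartRep σ x) (extChartAt 𝓘(ℝ, E) x x))
    (funext fun i => (fderiv_transition_eq hy hxx (v i)).symm)

theorem IsSmoothForm.extD {k : ℕ} {σ : Form (E := E) M k} (hσ : IsSmoothForm σ) :
    IsSmoothForm (extD σ) := by
  refine isSmoothForm_iff.2 fun x => ?_
  refine ((isSmoothForm_iff.1 hσ x).extDeriv).congr_of_eventuallyEq ?_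
  filter_upwards [extChartAt_target_mem_nhds x] with y hy using chartRep_extD hσ x hy

/-- The derivative of the inverse chart is invertible, so the value of a form at the centre of the
chart can be recovered from its representative. -/
theorem Form.ext_chartRep {k : ℕ} {σ τ : Form (E := E) M k} {x : M}
    (h : chartRep σ x (extChartAt 𝓘(ℝ, E) x x) = chartRep τ x (extChartAt 𝓘(ℝ, E) x x)) :
    σ x = τ x := by
  have hx := mem_extChartAt_target (I := 𝓘(ℝ, E)) x
  have key : σ ((extChartAt 𝓘(ℝ, E) x).symm (extChartAt 𝓘(ℝ, E) x x)) =
      τ ((extChartAt 𝓘(ℝ, E) x).symm (extChartAt 𝓘(ℝ, E) x x)) := by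
    ext v
    have h1 := DFunLike.congr_fun h (fun i => chartD x _ (v i))
    rw [chartRep_eq, chartRep_eq] at h1
    have h2 : chartSymmD x (extChartAt 𝓘(ℝ, E) x x) ∘
        (fun i => chartD x (extChartAt 𝓘(ℝ, E) x x) (v i)) = v :=
      funext fun i => chartSymmD_chartD x hx (v i)
    simp only [ContinuousAlternatingMap.compContinuousLinearMap_apply, h2] at h1
    exact h1
  rwa [extChartAt_to_inv] at key

theorem extD_extD {k : ℕ} {σ : Form (E := E) M k} (hσ : IsSmoothForm σ) :
    GradedForms.extD (GradedForms.extD σ) = 0 := by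
  funext x
  refine Form.ext_chartRep ?_
  have h : chartRep (GradedForms.extD σ) x =ᶠ[𝓝 (extChartAt 𝓘(ℝ, E) x x)]
      extDeriv (chartRep σ x) := by
    filter_upwards [extChartAt_target_mem_nhds x] with y hy using chartRep_extD hσ x hy
  rw [chartRep_extD hσ.extD x (mem_extChartAt_target x), h.extDeriv_eq,
    extDeriv_extDeriv_apply (isSmoothForm_iff.1 hσ x) (by simp; norm_cast)]
  rfl

end Charts
-- Insertion of an endomorphism as a vector-valued 1-form.
section Insertion

variable {V : Type*} [AddCommGroup V] [Module ℝ V] [TopologicalSpace V]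

theorem insertMultilinear_ofSubsingleton_apply {n : ℕ} (h : 1 ≤ n + 1) (K : V →L[ℝ] V)
    (σ : V [⋀^Fin (n + 1)]→L[ℝ] ℝ) (v : Fin (n + 1) → V) :
    insertMultilinear h (ContinuousAlternatingMap.ofSubsingleton ℝ _ _ (0 : Fin 1) K) σ v =
      σ (Function.update v 0 (K (v 0))) := by
  change σ _ = σ _
  congr 1
  ext j
  refine Fin.cases ?_ (fun j => ?_) j
  · simp
  · simp only [Fin.cons_succ, ne_eq, Fin.succ_ne_zero, not_false_eq_true, Function.update_of_ne]
    congr 1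
    ext
    simp [add_comm]

/-- By antisymmetry the sign of a permutation `s` cancels, so its term depends only on `s 0`. Each
value of `s 0` is taken by `n!` permutations, which the normalizing factor removes. -/
theorem insertForm_ofSubsingleton_apply [IsTopologicalAddGroup V] [ContinuousSMul ℝ V]
    {n : ℕ} (h : 1 ≤ n + 1) (K : V →L[ℝ] V)
    (σ : V [⋀^Fin (n + 1)]→L[ℝ] ℝ) (v : Fin (n + 1) → V) :
    insertForm h (ContinuousAlternatingMap.ofSubsingleton ℝ _ _ (0 : Fin 1) K) σ v =
      ∑ i, σ (Function.update v i (K (v i))) := by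
  have h1 : ∀ s : Equiv.Perm (Fin (n + 1)), Equiv.Perm.sign s •
      insertMultilinear h (ContinuousAlternatingMap.ofSubsingleton ℝ _ _ (0 : Fin 1) K) σ
        (v ∘ s) = σ (Function.update v (s 0) (K (v (s 0)))) := fun s => by
    rw [insertMultilinear_ofSubsingleton_apply]
    have h2 : Function.update (v ∘ s) 0 (K ((v ∘ s) 0)) =
        Function.update v (s 0) (K (v (s 0))) ∘ s :=
      (Function.update_comp_eq_of_injective v s.injective 0 _).symm
    have h3 := σ.toAlternatingMap.map_perm (Function.update v (s 0) (K (v (s 0)))) s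
    rw [ContinuousAlternatingMap.coe_toAlternatingMap] at h3
    rw [h2, h3, smul_smul]
    simp
  have h4 : ∑ s : Equiv.Perm (Fin (n + 1)), σ (Function.update v (s 0) (K (v (s 0)))) =
      (n.factorial : ℝ) * ∑ i, σ (Function.update v i (K (v i))) := by
    -- A permutation of `Fin (n + 1)` amounts to the image of `0` together with a permutation of
    -- `Fin n`.
    rw [← Equiv.Perm.decomposeFin.symm.sum_comp, Fintype.sum_prod_type, Finset.mul_sum]
    refine Finset.sum_congr rfl fun i _ => ?_
    simp [Equiv.Perm.decomposeFin_symm_apply_zero, Fintype.card_perm]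
  have hn : (n.factorial : ℝ) ≠ 0 := by positivity
  simp only [insertForm]
  rw [ContinuousAlternatingMap.smul_apply, ContinuousMultilinearMap.alternatization_apply_apply]
  rw [Finset.sum_congr rfl fun s _ => h1 s, h4]
  simp [hn]

end Insertion

/-! ### Coordinate expressions and smoothness of the operators. -/

section Operators

open Filter
open scoped Topology

variable {E : Type*} [NormedAddCommGroup E] [NormedSpace ℝ E]
variable {M : Type*} [TopologicalSpace M] [ChartedSpace E M]

theorem insertion_toVForm_apply (Φ : EndField (E := E) M) (σ : Forms (E := E) M) (k : ℕ) (x : M)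
    (v : Fin k → TangentSpace 𝓘(ℝ, E) x) :
    insertion Φ.toVForm σ k x v = ∑ i, σ k x (Function.update v i (Φ x (v i))) := by
  cases k with
  | zero => simp [insertion]
  | succ n =>
    have h : 1 ≤ n + 1 := by omega
    simp only [insertion, h, dif_pos]
    exact insertForm_ofSubsingleton_apply h (Φ x) (σ (n + 1) x) v

variable [IsManifold 𝓘(ℝ, E) ∞ M]

theorem endRep_apply_chartD (A : EndField (E := E) M) (x₀ : M) {y : E}
    (hy : y ∈ (extChartAt 𝓘(ℝ, E) x₀).target) (v : E) :
    chartSymmD x₀ y (endRep A x₀ y v) =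
      A ((extChartAt 𝓘(ℝ, E) x₀).symm y) (chartSymmD x₀ y v) :=
  chartSymmD_chartD x₀ hy _

theorem chartRep_act (A : EndField (E := E) M) (σ : Forms (E := E) M) (k : ℕ) (x₀ : M) {y : E}
    (hy : y ∈ (extChartAt 𝓘(ℝ, E) x₀).target) :
    chartRep (act A σ k) x₀ y = (chartRep (σ k) x₀ y).compContinuousLinearMap (endRep A x₀ y) := by
  ext v
  exact congrArg (σ k ((extChartAt 𝓘(ℝ, E) x₀).symm y))
    (funext fun i => (endRep_apply_chartD A x₀ hy (v i)).symm)

theorem chartRep_insertion (Φ : EndField (E := E) M) (σ : Forms (E := E) M) (k : ℕ) (x₀ : M)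
    {y : E} (hy : y ∈ (extChartAt 𝓘(ℝ, E) x₀).target) :
    chartRep (insertion Φ.toVForm σ k) x₀ y =
      insertEnd (chartRep (σ k) x₀ y) (endRep Φ x₀ y) := by
  ext v
  rw [insertEnd_apply, chartRep_eq, chartRep_eq]
  refine (insertion_toVForm_apply Φ σ k _ _).trans (Finset.sum_congr rfl fun i _ => ?_)
  refine congrArg (σ k ((extChartAt 𝓘(ℝ, E) x₀).symm y)) (funext fun j => ?_)
  rcases eq_or_ne j i with rfl | hj
  · simpa using! (endRep_apply_chartD Φ x₀ hy (v j)).symm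
  · simp [hj]

/-- A family of forms with smooth components. -/
def IsSmoothForms (σ : Forms (E := E) M) : Prop := ∀ k, IsSmoothForm (σ k)

theorem IsSmoothForms.insertion {Φ : EndField (E := E) M} (hΦ : IsSmoothEndField Φ)
    {σ : Forms (E := E) M} (hσ : IsSmoothForms σ) : IsSmoothForms (insertion Φ.toVForm σ) := by
  refine fun k => isSmoothForm_iff.2 fun x => ?_
  refine ((isSmoothForm_iff.1 (hσ k) x).insertEnd (hΦ.contDiffAt x)).congr_of_eventuallyEq ?_
  filter_upwards [extChartAt_target_mem_nhds x] with y hy using chartRep_insertion Φ σ k x hy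

theorem IsSmoothForms.act [FiniteDimensional ℝ E] {A : EndField (E := E) M}
    (hA : ∀ x, ContDiffAt ℝ ∞ (endRep A x) (extChartAt 𝓘(ℝ, E) x x))
    {σ : Forms (E := E) M} (hσ : IsSmoothForms σ) : IsSmoothForms (act A σ) := by
  refine fun k => isSmoothForm_iff.2 fun x => ?_
  refine ((isSmoothForm_iff.1 (hσ k) x).alternating_comp (hA x)).congr_of_eventuallyEq ?_
  filter_upwards [extChartAt_target_mem_nhds x] with y hy using chartRep_act A σ k x hy

theorem isSmoothForm_zero {k : ℕ} : IsSmoothForm (0 : Form (E := E) M k) :=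
  isSmoothForm_iff.2 fun _ => contDiffAt_const (c := (0 : E [⋀^Fin k]→L[ℝ] ℝ))

theorem IsSmoothForm.sub {k : ℕ} {σ τ : Form (E := E) M k} (hσ : IsSmoothForm σ)
    (hτ : IsSmoothForm τ) : IsSmoothForm (σ - τ) :=
  isSmoothForm_iff.2 fun x => (isSmoothForm_iff.1 hσ x).sub (isSmoothForm_iff.1 hτ x)

theorem IsSmoothForms.d {σ : Forms (E := E) M} (hσ : IsSmoothForms σ) : IsSmoothForms (d σ)
  | 0 => isSmoothForm_zero
  | k + 1 => (hσ k).extD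

theorem IsSmoothForms.sub {σ τ : Forms (E := E) M} (hσ : IsSmoothForms σ)
    (hτ : IsSmoothForms τ) : IsSmoothForms (σ - τ) := fun k => (hσ k).sub (hτ k)

theorem d_d {σ : Forms (E := E) M} (hσ : IsSmoothForms σ) : d (d σ) = 0 := by
  funext k
  match k with
  | 0 => rfl
  -- The degree-zero component of `d σ` is zero by definition, so this component is the exterior
  -- derivative of the zero function.
  | 1 =>
    funext x
    refine Form.ext_chartRep ?_
    exact (chartRep_extD isSmoothForm_zero x (mem_extChartAt_target x)).trans
      (extDeriv_zero_apply _)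
  | k + 2 => exact extD_extD (hσ k)

theorem IsSmoothForm.extD_sub {k : ℕ} {σ τ : Form (E := E) M k} (hσ : IsSmoothForm σ)
    (hτ : IsSmoothForm τ) : GradedForms.extD (σ - τ) = GradedForms.extD σ - GradedForms.extD τ := by
  funext x
  have hx := mem_extChartAt_target (I := 𝓘(ℝ, E)) x
  refine Form.ext_chartRep ((chartRep_extD (hσ.sub hτ) x hx).trans ?_)
  have h1 : chartRep (GradedForms.extD σ - GradedForms.extD τ) x (extChartAt 𝓘(ℝ, E) x x) =
    chartRep (GradedForms.extD σ) x (extChartAt 𝓘(ℝ, E) x x) -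
      chartRep (GradedForms.extD τ) x (extChartAt 𝓘(ℝ, E) x x) := rfl
  have h2 : chartRep (σ - τ) x = chartRep σ x - chartRep τ x := rfl
  rw [h1, chartRep_extD hσ x hx, chartRep_extD hτ x hx, h2, extDeriv, extDeriv, extDeriv,
    fderiv_sub ((isSmoothForm_iff.1 hσ x).differentiableAt (by simp))
      ((isSmoothForm_iff.1 hτ x).differentiableAt (by simp)), sub_eq_add_neg, sub_eq_add_neg,
    ContinuousAlternatingMap.alternatizeUncurryFin_add]
  congr 1
  exact (ContinuousAlternatingMap.alternatizeUncurryFinCLM ℝ E ℝ).map_neg _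

theorem IsSmoothForms.d_sub {σ τ : Forms (E := E) M} (hσ : IsSmoothForms σ)
    (hτ : IsSmoothForms τ) : GradedForms.d (σ - τ) = GradedForms.d σ - GradedForms.d τ := by
  funext k
  match k with
  | 0 => exact (sub_zero _).symm
  | k + 1 => exact (hσ k).extD_sub (hτ k)

theorem endRep_rOp (Φ : EndField (E := E) M) (x₀ : M) {y : E}
    (hy : y ∈ (extChartAt 𝓘(ℝ, E) x₀).target) :
    endRep (rOp Φ) x₀ y = ContinuousLinearMap.id ℝ E + endRep Φ x₀ y := by
  ext v
  simp only [endRep, rOp, ContinuousLinearMap.comp_apply, add_apply, map_add,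
    ContinuousLinearMap.id_apply]
  rw [chartD_chartSymmD x₀ hy]

theorem endRep_comp_eq_id {A B : EndField (E := E) M} (x₀ : M) {y : E}
    (hy : y ∈ (extChartAt 𝓘(ℝ, E) x₀).target)
    (h : ∀ x, (A x).comp (B x) = ContinuousLinearMap.id ℝ _) :
    (endRep A x₀ y).comp (endRep B x₀ y) = ContinuousLinearMap.id ℝ E := by
  ext v
  have h1 := DFunLike.congr_fun (h ((extChartAt 𝓘(ℝ, E) x₀).symm y)) (chartSymmD x₀ y v)
  simp only [ContinuousLinearMap.comp_apply, ContinuousLinearMap.id_apply] at h1 ⊢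
  rw [endRep, ContinuousLinearMap.comp_apply, ContinuousLinearMap.comp_apply,
    endRep_apply_chartD B x₀ hy, h1, chartD_chartSymmD x₀ hy]

/-- Inversion is smooth near an invertible operator, and the representative of a pointwise inverse
is the inverse of the representative. -/
theorem contDiffAt_endRep_inverse [CompleteSpace E] {A B : EndField (E := E) M} {x : M}
    (hA : ContDiffAt ℝ ∞ (endRep A x) (extChartAt 𝓘(ℝ, E) x x))
    (hAB : ∀ x, (A x).comp (B x) = ContinuousLinearMap.id ℝ _)
    (hBA : ∀ x, (B x).comp (A x) = ContinuousLinearMap.id ℝ _) :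
    ContDiffAt ℝ ∞ (endRep B x) (extChartAt 𝓘(ℝ, E) x x) := by
  have hx := mem_extChartAt_target (I := 𝓘(ℝ, E)) x
  have h1 : (endRep A x (extChartAt 𝓘(ℝ, E) x x)).IsInvertible :=
    ContinuousLinearMap.IsInvertible.of_inverse (endRep_comp_eq_id x hx hAB)
      (endRep_comp_eq_id x hx hBA)
  have h2 : ContDiffAt ℝ ∞ ContinuousLinearMap.inverse (endRep A x (extChartAt 𝓘(ℝ, E) x x)) := by
    obtain ⟨e, he⟩ := h1
    rw [← he]
    exact contDiffAt_map_inverse e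
  refine (h2.comp _ hA).congr_of_eventuallyEq ?_
  filter_upwards [extChartAt_target_mem_nhds x] with y hy
  exact (ContinuousLinearMap.inverse_eq (endRep_comp_eq_id x hy hAB)
    (endRep_comp_eq_id x hy hBA)).symm

end Operators
-- The formula for `e_Φ - L_Φ` and the Nijenhuis tensor on the manifold.
section LocalFormula

open Filter ContinuousAlternatingMap
open scoped Topology

variable {E : Type*} [NormedAddCommGroup E] [NormedSpace ℝ E]
variable {M : Type*} [TopologicalSpace M] [ChartedSpace E M]

theorem lieD_toVForm (Φ : EndField (E := E) M) (σ : Forms (E := E) M) :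
    lieD Φ.toVForm σ = insertion Φ.toVForm (d σ) - d (insertion Φ.toVForm σ) := by
  simp [lieD, gradedComm]

theorem rOp_comp_invField {Φ : EndField (E := E) M} (h : IsInvertibleField (rOp Φ)) (x : M) :
    (rOp Φ x).comp (invField (rOp Φ) x) = ContinuousLinearMap.id ℝ _ :=
  (h x).self_comp_inverse

theorem invField_comp_rOp {Φ : EndField (E := E) M} (h : IsInvertibleField (rOp Φ)) (x : M) :
    (invField (rOp Φ) x).comp (rOp Φ x) = ContinuousLinearMap.id ℝ _ :=
  (h x).inverse_comp_self

theorem eSol_sub_lieD_zero (Φ : EndField (E := E) M) (σ : Forms (E := E) M) :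
    eSol Φ σ 0 = lieD Φ.toVForm σ 0 := by
  rw [lieD_toVForm]
  funext x
  ext v
  change (0 : ℝ) - 0 = insertion Φ.toVForm (d σ) 0 x v - 0
  rw [insertion_toVForm_apply]
  simp

variable [IsManifold 𝓘(ℝ, E) ∞ M]

theorem IsSmoothForms.lieD {Φ : EndField (E := E) M} (hΦ : IsSmoothEndField Φ)
    {σ : Forms (E := E) M} (hσ : IsSmoothForms σ) : IsSmoothForms (lieD Φ.toVForm σ) := by
  rw [lieD_toVForm]
  exact (hσ.d.insertion hΦ).sub (hσ.insertion hΦ).d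

theorem contDiffAt_endRep_rOp {Φ : EndField (E := E) M} (hΦ : IsSmoothEndField Φ) (x : M) :
    ContDiffAt ℝ ∞ (endRep (rOp Φ) x) (extChartAt 𝓘(ℝ, E) x x) := by
  refine (contDiffAt_const (c := ContinuousLinearMap.id ℝ E)).add
    (hΦ.contDiffAt x) |>.congr_of_eventuallyEq ?_
  filter_upwards [extChartAt_target_mem_nhds x] with y hy using endRep_rOp Φ x hy

variable [FiniteDimensional ℝ E]

theorem contDiffAt_endRep_invField {Φ : EndField (E := E) M} (hΦ : IsSmoothEndField Φ)
    (h : IsInvertibleField (rOp Φ)) (x : M) :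
    ContDiffAt ℝ ∞ (endRep (invField (rOp Φ)) x) (extChartAt 𝓘(ℝ, E) x x) :=
  have := FiniteDimensional.complete ℝ E
  contDiffAt_endRep_inverse (contDiffAt_endRep_rOp hΦ x) (rOp_comp_invField h)
    (invField_comp_rOp h)

theorem IsSmoothForms.dDef {Φ : EndField (E := E) M} (hΦ : IsSmoothEndField Φ)
    (h : IsInvertibleField (rOp Φ)) {σ : Forms (E := E) M} (hσ : IsSmoothForms σ) :
    IsSmoothForms (dDef Φ σ) :=
  (hσ.act (contDiffAt_endRep_invField hΦ h)).d.act (contDiffAt_endRep_rOp hΦ)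

theorem IsSmoothForms.eSol {Φ : EndField (E := E) M} (hΦ : IsSmoothEndField Φ)
    (h : IsInvertibleField (rOp Φ)) {σ : Forms (E := E) M} (hσ : IsSmoothForms σ) :
    IsSmoothForms (eSol Φ σ) :=
  (hσ.dDef hΦ h).sub hσ.d

/-- In a chart, `e_Φ - L_Φ` is the insertion of `torsionMap`. -/
theorem chartRep_eSol_sub_lieD {Φ : EndField (E := E) M} (hΦ : IsSmoothEndField Φ)
    (h : IsInvertibleField (rOp Φ)) {σ : Forms (E := E) M} (hσ : IsSmoothForms σ) (k : ℕ) (x : M) :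
    chartRep (GradedForms.eSol Φ σ (k + 1)) x (extChartAt 𝓘(ℝ, E) x x) =
      chartRep (GradedForms.lieD Φ.toVForm σ (k + 1)) x (extChartAt 𝓘(ℝ, E) x x) +
      alternatizeUncurryFin ((chartRep (σ k) x (extChartAt 𝓘(ℝ, E) x x)).fderivCompContinuousLinearMap
        (ContinuousLinearMap.id ℝ E) ∘L torsionMap (endRep Φ x) (endRep (invField (rOp Φ)) x)
          (extChartAt 𝓘(ℝ, E) x x)) := by
  have hx := mem_extChartAt_target (I := 𝓘(ℝ, E)) x
  have hnhds := extChartAt_target_mem_nhds (I := 𝓘(ℝ, E)) x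
  have hinv := contDiffAt_endRep_invField hΦ h
  have key := extDeriv_comp_sub_extDeriv_eq
    ((isSmoothForm_iff.1 (hσ k) x).differentiableAt (by simp))
    ((hΦ.contDiffAt x).differentiableAt (by simp)) ((hinv x).differentiableAt (by simp)) (by
      filter_upwards [hnhds] with y hy
      rw [← endRep_rOp Φ x hy]
      exact endRep_comp_eq_id x hy (invField_comp_rOp h))
  have h1 : extDeriv (chartRep (act (invField (rOp Φ)) σ k) x) (extChartAt 𝓘(ℝ, E) x x) =
      extDeriv (fun y => (chartRep (σ k) x y).compContinuousLinearMap
        (endRep (invField (rOp Φ)) x y)) (extChartAt 𝓘(ℝ, E) x x) := by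
    refine Filter.EventuallyEq.extDeriv_eq ?_
    filter_upwards [hnhds] with y hy using chartRep_act _ σ k x hy
  have h2 : extDeriv (chartRep (insertion Φ.toVForm σ k) x) (extChartAt 𝓘(ℝ, E) x x) =
      extDeriv (fun y => insertEnd (chartRep (σ k) x y) (endRep Φ x y))
        (extChartAt 𝓘(ℝ, E) x x) := by
    refine Filter.EventuallyEq.extDeriv_eq ?_
    filter_upwards [hnhds] with y hy using chartRep_insertion Φ σ k x hy
  have h3 : chartRep (GradedForms.eSol Φ σ (k + 1)) x (extChartAt 𝓘(ℝ, E) x x) =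
      chartRep (GradedForms.dDef Φ σ (k + 1)) x (extChartAt 𝓘(ℝ, E) x x) -
        chartRep (extD (σ k)) x (extChartAt 𝓘(ℝ, E) x x) := rfl
  have h4 : chartRep (GradedForms.lieD Φ.toVForm σ (k + 1)) x (extChartAt 𝓘(ℝ, E) x x) =
      chartRep (insertion Φ.toVForm (GradedForms.d σ) (k + 1)) x (extChartAt 𝓘(ℝ, E) x x) -
        chartRep (extD (insertion Φ.toVForm σ k)) x (extChartAt 𝓘(ℝ, E) x x) := by
    rw [lieD_toVForm]; rfl
  have h5 : chartRep (GradedForms.d (act (invField (rOp Φ)) σ) (k + 1)) x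
      (extChartAt 𝓘(ℝ, E) x x) = extDeriv (chartRep (act (invField (rOp Φ)) σ k) x)
      (extChartAt 𝓘(ℝ, E) x x) := chartRep_extD (hσ.act hinv k) x hx
  have h6 : chartRep (GradedForms.d σ (k + 1)) x (extChartAt 𝓘(ℝ, E) x x) =
    extDeriv (chartRep (σ k) x) (extChartAt 𝓘(ℝ, E) x x) := chartRep_extD (hσ k) x hx
  rw [h3, h4, GradedForms.dDef, chartRep_act _ _ _ x hx, h5, h1, endRep_rOp Φ x hx,
    chartRep_extD (hσ k) x hx, key, chartRep_insertion _ _ _ x hx, h6,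
    chartRep_extD (hσ.insertion hΦ k) x hx, h2]

omit [FiniteDimensional ℝ E] in
theorem endRep_self (A : EndField (E := E) M) (x : M) (v : E) :
    endRep A x (extChartAt 𝓘(ℝ, E) x x) v = (A x v : E) := by
  have : IsManifold 𝓘(ℝ, E) 1 M := IsManifold.of_le (n := ∞) (by norm_cast)
  have h1 : ∀ w : E, (chartSymmD x (extChartAt 𝓘(ℝ, E) x x) w : E) = w := fun w => by
    have h := mfderivWithin_range_extChartAt_symm (I := 𝓘(ℝ, E)) (x := x)
    rw [modelWithCornersSelf_coe, Set.range_id, mfderivWithin_univ] at h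
    exact DFunLike.congr_fun h w
  -- The base point `(extChartAt x).symm (extChartAt x x)` equals `x` only propositionally, so it is
  -- generalized before substitution.
  have h2 : ∀ p : M, p = x → ∀ w : E,
      (mfderiv 𝓘(ℝ, E) 𝓘(ℝ, E) (extChartAt 𝓘(ℝ, E) x) p (A p w) : E) = (A x w : E) := by
    rintro p rfl w
    exact DFunLike.congr_fun (mfderiv_extChartAt_self (I := 𝓘(ℝ, E)) (x := p)) (A p w)
  refine (h2 _ (extChartAt_to_inv x) _).trans ?_
  exact congrArg (fun w : E => (A x w : E)) (h1 v)

omit [FiniteDimensional ℝ E] in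
theorem vecRep_self (X : VField (E := E) M) (x : M) :
    vecRep X x (extChartAt 𝓘(ℝ, E) x x) = (X x : E) := by
  have : IsManifold 𝓘(ℝ, E) 1 M := IsManifold.of_le (n := ∞) (by norm_cast)
  have h2 : ∀ p : M, p = x →
      (mfderiv 𝓘(ℝ, E) 𝓘(ℝ, E) (extChartAt 𝓘(ℝ, E) x) p (X p) : E) = (X x : E) := by
    rintro p rfl
    exact DFunLike.congr_fun (mfderiv_extChartAt_self (I := 𝓘(ℝ, E)) (x := p)) (X p)
  exact h2 _ (extChartAt_to_inv x)

omit [FiniteDimensional ℝ E] in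
theorem vecRep_app (A : EndField (E := E) M) (X : VField (E := E) M) (x : M) {y : E}
    (hy : y ∈ (extChartAt 𝓘(ℝ, E) x).target) :
    vecRep (A.app X) x y = endRep A x y (vecRep X x y) := by
  simp only [vecRep, endRep, ContinuousLinearMap.comp_apply, EndField.app]
  rw [chartSymmD_chartD x hy]

omit [FiniteDimensional ℝ E] in
-- The bracket on `M` pulls fields back along the inverse chart, that is by the inverse of
-- `chartSymmD`, which is `chartD`. At its own centre the preferred chart has identity derivative.
theorem bracket_apply (X Y : VField (E := E) M) (x : M) :
    bracket X Y x = (VectorField.lieBracket ℝ (vecRep X x) (vecRep Y x)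
      (extChartAt 𝓘(ℝ, E) x x) : E) := by
  have : IsManifold 𝓘(ℝ, E) 1 M := IsManifold.of_le (n := ∞) (by norm_cast)
  have h : ∀ Z : VField (E := E) M,
      VectorField.mpullbackWithin 𝓘(ℝ, E) 𝓘(ℝ, E) (extChartAt 𝓘(ℝ, E) x).symm Z
        (Set.range 𝓘(ℝ, E)) =ᶠ[𝓝 (extChartAt 𝓘(ℝ, E) x x)] vecRep Z x := fun Z => by
    filter_upwards [extChartAt_target_mem_nhds x] with y hy
    rw [VectorField.mpullbackWithin_apply, modelWithCornersSelf_coe, Set.range_id,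
      mfderivWithin_univ]
    exact DFunLike.congr_fun (ContinuousLinearMap.inverse_eq (chartSymmD_comp_chartD x hy)
      (chartD_comp_chartSymmD x hy)) _
  have hinv : ∀ v : E, ((mfderiv 𝓘(ℝ, E) 𝓘(ℝ, E) (extChartAt 𝓘(ℝ, E) x) x).inverse v : E) = v :=
    fun v => by
      rw [mfderiv_extChartAt_self]
      exact DFunLike.congr_fun (ContinuousLinearMap.inverse_id (R := ℝ) (M := E)) v
  refine (VectorField.mlieBracketWithin_apply (I := 𝓘(ℝ, E))).trans ((hinv _).trans ?_)
  have hs : (extChartAt 𝓘(ℝ, E) x).symm ⁻¹' Set.univ ∩ Set.range 𝓘(ℝ, E) = Set.univ := by simp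
  refine Eq.trans ?_ ((h X).lieBracket_vectorField_eq (h Y))
  rw [hs]
  exact congrFun (VectorField.lieBracketWithin_univ (𝕜 := ℝ) (E := E)) _

omit [FiniteDimensional ℝ E] in
theorem nijenhuis_apply {Φ : EndField (E := E) M} (hΦ : IsSmoothEndField Φ)
    {X Y : VField (E := E) M} (hX : IsSmoothVField X) (hY : IsSmoothVField Y) (x : M) :
    nijenhuis Φ X Y x = nijenhuisAt (endRep Φ x) (extChartAt 𝓘(ℝ, E) x x) (X x) (Y x) := by
  have happ : ∀ Z : VField (E := E) M, vecRep (Φ.app Z) x =ᶠ[𝓝 (extChartAt 𝓘(ℝ, E) x x)]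
      fun y => endRep Φ x y (vecRep Z x y) := fun Z => by
    filter_upwards [extChartAt_target_mem_nhds x] with y hy using vecRep_app Φ Z x hy
  have key := nijenhuisAt_eq_lieBracket ((hΦ.contDiffAt x).differentiableAt (by simp))
    ((hX.contDiffAt x).differentiableAt (by simp)) ((hY.contDiffAt x).differentiableAt (by simp))
  have h1 := (bracket_apply (Φ.app X) (Φ.app Y) x).trans
    ((happ X).lieBracket_vectorField_eq (happ Y))
  have h2 := (bracket_apply (Φ.app X) Y x).trans
    ((happ X).lieBracket_vectorField_eq (EventuallyEq.refl _ (vecRep Y x)))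
  have h3 := (bracket_apply X (Φ.app Y) x).trans
    ((EventuallyEq.refl _ (vecRep X x)).lieBracket_vectorField_eq (happ Y))
  have hΦx : endRep Φ x (extChartAt 𝓘(ℝ, E) x x) = (show E →L[ℝ] E from Φ x) :=
    ContinuousLinearMap.ext fun v => endRep_self Φ x v
  rw [← h1, ← h2, ← h3, ← bracket_apply X Y x, vecRep_self, vecRep_self, hΦx] at key
  exact key

end LocalFormula

/-! ### Globalizing vectors and covectors with bump functions. -/

section Existence

open Filter
open scoped Topology

variable {E : Type*} [NormedAddCommGroup E] [NormedSpace ℝ E] [FiniteDimensional ℝ E]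
variable {M : Type*} [TopologicalSpace M] [ChartedSpace E M] [IsManifold 𝓘(ℝ, E) ∞ M] [T2Space M]

theorem exists_isSmoothVField_apply_eq (x : M) (v : TangentSpace 𝓘(ℝ, E) x) :
    ∃ X : VField (E := E) M, IsSmoothVField X ∧ X x = v := by
  have : IsManifold 𝓘(ℝ, E) (∞ + 1) M := ‹IsManifold 𝓘(ℝ, E) ∞ M›
  obtain ⟨s, hs, hX⟩ := FiberBundle.exists_contMDiffOn_extend (k := ∞) 𝓘(ℝ, E) E v
  obtain ⟨f, -, hf⟩ := (SmoothBumpFunction.nhds_basis_tsupport (I := 𝓘(ℝ, E)) x).mem_iff.1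
    (interior_mem_nhds.2 hs)
  refine ⟨fun z => f z • FiberBundle.extend E v z,
    ContMDiffOn.smul_section_of_tsupport (u := interior s) f.contMDiff.contMDiffOn isOpen_interior
      hf (hX.mono interior_subset), ?_⟩
  simp

/-- The coordinate function `l` times a bump function equals `l` near `x`, so every covector at `x`
is the differential of a global smooth function. -/
theorem exists_isSmoothForm_extD_eq (x : M) (l : E →L[ℝ] ℝ) :
    ∃ f : Form (E := E) M 0, IsSmoothForm f ∧ chartRep (extD f) x (extChartAt 𝓘(ℝ, E) x x) =
      ContinuousAlternatingMap.ofSubsingleton ℝ E ℝ (0 : Fin 1) l := by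
  obtain ⟨b⟩ : Nonempty (SmoothBumpFunction 𝓘(ℝ, E) x) := inferInstance
  let g : M → ℝ := fun z => b z • l (extChartAt 𝓘(ℝ, E) x z)
  have hg : ContMDiff 𝓘(ℝ, E) 𝓘(ℝ, ℝ) ∞ g := by
    refine b.contMDiff_smul ?_
    exact l.contMDiff.comp_contMDiffOn (contMDiffOn_extChartAt (I := 𝓘(ℝ, E)))
  let f : Form (E := E) M 0 := fun z =>
    ContinuousAlternatingMap.constOfIsEmpty ℝ _ (Fin 0) (g z)
  have hf : IsSmoothForm f := by
    refine isSmoothForm_iff.2 fun z => contDiffAt_alternating_of_forall_apply fun v => ?_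
    rw [← contMDiffAt_iff_contDiffAt]
    exact hg.contMDiffAt.comp _ (contMDiffAt_extChartAt_symm z (mem_extChartAt_target z))
  refine ⟨f, hf, ?_⟩
  have h1 : chartRep f x =ᶠ[𝓝 (extChartAt 𝓘(ℝ, E) x x)]
      fun y => ContinuousAlternatingMap.constOfIsEmpty ℝ E (Fin 0) (l y) := by
    have h2 := (contMDiffAt_extChartAt_symm x
      (mem_extChartAt_target x)).continuousAt.eventually (by
        rw [extChartAt_to_inv (I := 𝓘(ℝ, E))]; exact b.eventuallyEq_one)
    filter_upwards [extChartAt_target_mem_nhds x, h2] with y hy hby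
    ext v
    change g _ = l y
    simp only [g]
    rw [hby, (extChartAt 𝓘(ℝ, E) x).right_inv hy]
    simp
  rw [chartRep_extD hf x (mem_extChartAt_target x), h1.extDeriv_eq, extDeriv_constOfIsEmpty,
    l.fderiv]

end Existence
-- The Maurer-Cartan equation and the equivalences for `Φ`.
section MaurerCartan

open Filter ContinuousAlternatingMap
open scoped Topology

variable {E : Type*} [NormedAddCommGroup E] [NormedSpace ℝ E]
variable {M : Type*} [TopologicalSpace M] [ChartedSpace E M]

theorem insertion_toVForm_zero (Φ : EndField (E := E) M) :
    insertion Φ.toVForm (0 : Forms (E := E) M) = 0 := by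
  funext k x
  ext v
  rw [insertion_toVForm_apply]
  exact Finset.sum_eq_zero fun _ _ => rfl

theorem insertion_toVForm_congr (Φ : EndField (E := E) M) {σ τ : Forms (E := E) M} {k : ℕ}
    (h : σ k = τ k) : insertion Φ.toVForm σ k = insertion Φ.toVForm τ k := by
  funext x
  ext v
  rw [insertion_toVForm_apply, insertion_toVForm_apply, h]

theorem insertion_toVForm_sub (Φ : EndField (E := E) M) (σ τ : Forms (E := E) M) :
    insertion Φ.toVForm (σ - τ) = insertion Φ.toVForm σ - insertion Φ.toVForm τ := by
  funext k x
  ext v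
  refine (insertion_toVForm_apply Φ _ k x v).trans ?_
  refine Eq.trans ?_ (congrArg₂ (· - ·) (insertion_toVForm_apply Φ σ k x v)
    (insertion_toVForm_apply Φ τ k x v)).symm
  exact Finset.sum_sub_distrib _ _

/-- `L_Φ` raises degree by one, so a single component of the family may be replaced without control
of the others. -/
theorem lieD_toVForm_congr (Φ : EndField (E := E) M) {σ τ : Forms (E := E) M} {k : ℕ}
    (h : σ k = τ k) : lieD Φ.toVForm σ (k + 1) = lieD Φ.toVForm τ (k + 1) := by
  rw [lieD_toVForm, lieD_toVForm]
  exact congrArg₂ (· - ·) (insertion_toVForm_congr Φ (show d σ (k + 1) = d τ (k + 1) from congrArg extD h))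
    (congrArg extD (insertion_toVForm_congr Φ h))

theorem insertion_zero {k : ℕ} (σ : Forms (E := E) M) :
    insertion (0 : VForm (E := E) M k) σ = 0 := by
  funext m x
  by_cases h : k ≤ m
  · have h0 : insertMultilinear h (0 : TangentSpace 𝓘(ℝ, E) x [⋀^Fin k]→L[ℝ] TangentSpace 𝓘(ℝ, E) x)
        (σ (m - k + 1) x) = 0 := by
      ext v
      exact (σ (m - k + 1) x).map_coord_zero 0 rfl
    have h1 : insertForm h (0 : TangentSpace 𝓘(ℝ, E) x [⋀^Fin k]→L[ℝ] TangentSpace 𝓘(ℝ, E) x)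
        (σ (m - k + 1) x) = 0 := by
      rw [insertForm, h0, _root_.map_zero, smul_zero]
    simpa [insertion, h] using h1
  · simp [insertion, h]

theorem act_sub (A : EndField (E := E) M) (σ τ : Forms (E := E) M) :
    act A (σ - τ) = act A σ - act A τ := rfl

theorem act_zero (A : EndField (E := E) M) : act A (0 : Forms (E := E) M) = 0 := rfl

theorem act_act_of_comp_eq_id {A B : EndField (E := E) M}
    (h : ∀ x, (A x).comp (B x) = ContinuousLinearMap.id ℝ _) (σ : Forms (E := E) M) :
    act B (act A σ) = σ := by
  funext k x
  ext v
  exact congrArg (σ k x) (funext fun i => DFunLike.congr_fun (h x) (v i))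

theorem daleth_one_apply (P : Operator (E := E) M) (σ : Forms (E := E) M) :
    daleth 1 P σ = d (P σ) + P (d σ) := by
  simp [daleth, gradedComm]

variable [IsManifold 𝓘(ℝ, E) ∞ M]

theorem isSmoothForms_zero : IsSmoothForms (0 : Forms (E := E) M) := fun _ => isSmoothForm_zero

theorem d_zero : d (0 : Forms (E := E) M) = 0 := by
  have h := (isSmoothForms_zero (E := E) (M := M)).d_sub isSmoothForms_zero
  rwa [sub_self, sub_self] at h

theorem lieD_zero {k : ℕ} (σ : Forms (E := E) M) : lieD (0 : VForm (E := E) M k) σ = 0 := by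
  simp only [lieD, gradedComm, insertion_zero, d_zero, smul_zero, sub_zero]

theorem d_lieD_add_lieD_d {Φ : EndField (E := E) M} (hΦ : IsSmoothEndField Φ)
    {σ : Forms (E := E) M} (hσ : IsSmoothForms σ) :
    d (lieD Φ.toVForm σ) + lieD Φ.toVForm (d σ) = 0 := by
  rw [lieD_toVForm, lieD_toVForm, (hσ.d.insertion hΦ).d_sub (hσ.insertion hΦ).d,
    d_d (hσ.insertion hΦ), d_d hσ, insertion_toVForm_zero]
  abel

theorem lieD_toVForm_sub {Φ : EndField (E := E) M} (hΦ : IsSmoothEndField Φ)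
    {σ τ : Forms (E := E) M} (hσ : IsSmoothForms σ) (hτ : IsSmoothForms τ) :
    lieD Φ.toVForm (σ - τ) = lieD Φ.toVForm σ - lieD Φ.toVForm τ := by
  rw [lieD_toVForm, lieD_toVForm, lieD_toVForm, hσ.d_sub hτ, insertion_toVForm_sub,
    insertion_toVForm_sub, (hσ.insertion hΦ).d_sub (hτ.insertion hΦ)]
  abel

theorem isSmoothVForm_zero {k : ℕ} : IsSmoothVForm (0 : VForm (E := E) M k) :=
  Bundle.contMDiff_zeroSection ℝ
    (fun x : M => TangentSpace 𝓘(ℝ, E) x [⋀^Fin k]→L[ℝ] TangentSpace 𝓘(ℝ, E) x)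

/-- The canonical solution has finite type zero iff `L_Φ` squares to zero. -/
theorem hasFiniteType_zero_iff {Φ : EndField (E := E) M} :
    HasFiniteType Φ 0 ↔
      ∀ σ : Forms (E := E) M, IsSmoothForms σ → lieD Φ.toVForm (lieD Φ.toVForm σ) = 0 := by
  -- `L_Φ` has odd degree, so its graded commutator with itself is twice its square.
  have hcomm : ∀ σ : Forms (E := E) M,
      gradedComm (1 : ℕ) (1 : ℕ) (lieD Φ.toVForm) (lieD Φ.toVForm) σ =
        (2 : ℝ) • lieD Φ.toVForm (lieD Φ.toVForm σ) := fun σ => by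
    simp [gradedComm, two_smul]
  constructor
  · rintro ⟨B, ⟨-, hB⟩, h0, -⟩ σ hσ
    have hB0 : B = 0 := funext fun x => by
      have := h0 x
      rw [pow_zero] at this
      ext v
      exact DFunLike.congr_fun this v
    have h := hB σ hσ
    rw [hcomm, hB0, lieD_zero] at h
    exact (smul_eq_zero.1 h).resolve_left two_ne_zero
  · intro h
    -- The zero form itself serves as the bracket, and `0` is trivially the least exponent.
    refine ⟨0, ⟨isSmoothVForm_zero, fun σ hσ => ?_⟩, fun x => ?_, fun _ _ => Nat.zero_le _⟩
    · rw [hcomm, h σ hσ, smul_zero, lieD_zero]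
    · ext v
      simp

variable [FiniteDimensional ℝ E]

section

variable {Φ : EndField (E := E) M} (hΦ : IsSmoothEndField Φ) (h : IsInvertibleField (rOp Φ))
include hΦ h

theorem dDef_sub {σ τ : Forms (E := E) M} (hσ : IsSmoothForms σ) (hτ : IsSmoothForms τ) :
    dDef Φ (σ - τ) = dDef Φ σ - dDef Φ τ := by
  have hinv := contDiffAt_endRep_invField hΦ h
  simp only [dDef, act_sub, (hσ.act hinv).d_sub (hτ.act hinv)]

theorem dDef_dDef {σ : Forms (E := E) M} (hσ : IsSmoothForms σ) : dDef Φ (dDef Φ σ) = 0 := by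
  rw [dDef, dDef, act_act_of_comp_eq_id (rOp_comp_invField h),
    d_d (hσ.act (contDiffAt_endRep_invField hΦ h)), act_zero]

/-- This is `(d + e_Φ)² = d_Φ² = 0` expanded, using `d² = 0`. -/
theorem eSol_eSol {σ : Forms (E := E) M} (hσ : IsSmoothForms σ) :
    eSol Φ (eSol Φ σ) = -(d (eSol Φ σ) + eSol Φ (d σ)) := by
  have h1 : dDef Φ (eSol Φ σ) = - dDef Φ (d σ) := by
    rw [eSol, dDef_sub hΦ h (hσ.dDef hΦ h) hσ.d, dDef_dDef hΦ h hσ, zero_sub]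
  have h2 : eSol Φ (d σ) = dDef Φ (d σ) := by rw [eSol, d_d hσ, sub_zero]
  rw [h2, eSol, h1]
  abel

omit [FiniteDimensional ℝ E] hΦ in
theorem torsion_symm_iff (x : M) :
    (∀ u v, torsionMap (endRep Φ x) (endRep (invField (rOp Φ)) x) (extChartAt 𝓘(ℝ, E) x x) u v =
      torsionMap (endRep Φ x) (endRep (invField (rOp Φ)) x) (extChartAt 𝓘(ℝ, E) x x) v u) ↔
    ∀ u v, nijenhuisAt (endRep Φ x) (extChartAt 𝓘(ℝ, E) x x) u v = 0 := by
  have hx := mem_extChartAt_target (I := 𝓘(ℝ, E)) x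
  have hl := endRep_comp_eq_id x hx (invField_comp_rOp h)
  have hr := endRep_comp_eq_id x hx (rOp_comp_invField h)
  rw [endRep_rOp Φ x hx] at hl hr
  exact forall₂_congr fun u v => torsionMap_symm_iff hl hr u v

/-- A function has no argument into which the torsion could be inserted, so the correction vanishes.
-/
theorem eSol_one_eq_lieD {σ : Forms (E := E) M} (hσ : IsSmoothForms σ) :
    eSol Φ σ 1 = lieD Φ.toVForm σ 1 := by
  funext x
  refine Form.ext_chartRep ((chartRep_eSol_sub_lieD hΦ h hσ 0 x).trans ?_)
  rw [fderivCompContinuousLinearMap_of_isEmpty]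
  ext v
  simp [alternatizeUncurryFin_apply]

/-- Where `e_Φ` and `L_Φ` agree on a 1-form, its value annihilates the antisymmetric part of the
torsion; covectors separate vectors. -/
theorem nijenhuisVanishes_of_eSol_two_eq
    (H : ∀ (x : M) (l : E →L[ℝ] ℝ), ∃ σ : Forms (E := E) M, IsSmoothForms σ ∧
      eSol Φ σ 2 = lieD Φ.toVForm σ 2 ∧
      chartRep (σ 1) x (extChartAt 𝓘(ℝ, E) x x) = ofSubsingleton ℝ E ℝ (0 : Fin 1) l) :
    NijenhuisVanishes Φ := by
  intro X Y hX hY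
  funext x
  refine (nijenhuis_apply hΦ hX hY x).trans ((torsion_symm_iff h x).1 (fun u v => ?_) _ _)
  rw [← sub_eq_zero]
  refine SeparatingDual.eq_zero_of_forall_dual_eq_zero (R := ℝ) fun l => ?_
  obtain ⟨σ, hσ, h2, hl⟩ := H x l
  have h3 := chartRep_eSol_sub_lieD hΦ h hσ 1 x
  rw [h2, left_eq_add] at h3
  have h4 := DFunLike.congr_fun h3 ![u, v]
  rw [alternatize_torsion_one, hl] at h4
  simpa using h4

end

variable [T2Space M]

theorem eSol_eq_lieD {Φ : EndField (E := E) M} (hΦ : IsSmoothEndField Φ)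
    (h : IsInvertibleField (rOp Φ)) (hN : NijenhuisVanishes Φ) {σ : Forms (E := E) M}
    (hσ : IsSmoothForms σ) : eSol Φ σ = lieD Φ.toVForm σ := by
  funext k
  match k with
  | 0 => exact eSol_sub_lieD_zero Φ σ
  | k + 1 =>
    funext x
    refine Form.ext_chartRep ((chartRep_eSol_sub_lieD hΦ h hσ k x).trans ?_)
    rw [alternatize_torsion_eq_zero ((torsion_symm_iff h x).2 fun u v => ?_), add_zero]
    obtain ⟨X, hX, rfl⟩ := exists_isSmoothVField_apply_eq x u
    obtain ⟨Y, hY, rfl⟩ := exists_isSmoothVField_apply_eq x v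
    rw [← nijenhuis_apply hΦ hX hY x, hN X Y hX hY]
    rfl

theorem exists_isSmoothForms_d_eq (x : M) (l : E →L[ℝ] ℝ) :
    ∃ σ : Forms (E := E) M, IsSmoothForms σ ∧
      chartRep (extD (σ 0)) x (extChartAt 𝓘(ℝ, E) x x) = ofSubsingleton ℝ E ℝ (0 : Fin 1) l := by
  obtain ⟨f, hf, hl⟩ := exists_isSmoothForm_extD_eq x l
  refine ⟨fun k => match k with
    | 0 => f
    | _ + 1 => 0, fun k => ?_, hl⟩
  match k with
  | 0 => exact hf
  | _ + 1 => exact isSmoothForm_zero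

/-- Test on `df`: both `e_Φ` and `L_Φ` anticommute with `d` and they agree on `f`, hence they agree
on `df`. -/
theorem nijenhuisVanishes_of_isDalethClosed {Φ : EndField (E := E) M} (hΦ : IsSmoothEndField Φ)
    (h : IsInvertibleField (rOp Φ)) (hc : IsDalethClosed 1 (eSol Φ)) : NijenhuisVanishes Φ := by
  refine nijenhuisVanishes_of_eSol_two_eq hΦ h fun x l => ?_
  obtain ⟨σ, hσ, hl⟩ := exists_isSmoothForms_d_eq x l
  refine ⟨d σ, hσ.d, ?_, hl⟩
  have h1 := hc σ hσ
  rw [daleth_one_apply] at h1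
  have h2 : d (eSol Φ σ) 2 + eSol Φ (d σ) 2 = 0 := congrFun h1 2
  have h3 : d (lieD Φ.toVForm σ) 2 + lieD Φ.toVForm (d σ) 2 = 0 :=
    congrFun (d_lieD_add_lieD_d hΦ hσ) 2
  have h4 : d (eSol Φ σ) 2 = d (lieD Φ.toVForm σ) 2 :=
    congrArg extD (eSol_one_eq_lieD hΦ h hσ)
  rw [h4, ← h3] at h2
  exact add_left_cancel h2

/-- Test on `d_Φ f = df + L_Φ f`. From `d_Φ² = 0` one gets `e_Φ (d_Φ f) = -d (L_Φ f)`, and from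
`L_Φ² = 0` one gets `L_Φ (d_Φ f) = L_Φ (df) = -d (L_Φ f)`. -/
theorem nijenhuisVanishes_of_lieD_lieD {Φ : EndField (E := E) M} (hΦ : IsSmoothEndField Φ)
    (h : IsInvertibleField (rOp Φ))
    (hL : ∀ σ : Forms (E := E) M, IsSmoothForms σ → lieD Φ.toVForm (lieD Φ.toVForm σ) = 0) :
    NijenhuisVanishes Φ := by
  refine nijenhuisVanishes_of_eSol_two_eq hΦ h fun x l => ?_
  have hx := mem_extChartAt_target (I := 𝓘(ℝ, E)) x
  obtain ⟨σ, hσ, hl⟩ := exists_isSmoothForms_d_eq x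
    -- On functions `d_Φ f` is `df` composed with `R_Φ`, so prescribing `l ∘ R_Φ⁻¹` for `df` gives
    -- `d_Φ f` the value `l`.
    (l.comp (endRep (invField (rOp Φ)) x (extChartAt 𝓘(ℝ, E) x x)))
  refine ⟨dDef Φ σ, hσ.dDef hΦ h, ?_, ?_⟩
  · have h1 : eSol Φ σ 1 = lieD Φ.toVForm σ 1 := eSol_one_eq_lieD hΦ h hσ
    have h2 : d (dDef Φ σ) = d (eSol Φ σ) := by
      rw [eSol, (hσ.dDef hΦ h).d_sub hσ.d, d_d hσ, sub_zero]
    have h3 : eSol Φ (dDef Φ σ) = -d (eSol Φ σ) := by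
      rw [eSol, dDef_dDef hΦ h hσ, h2, zero_sub]
    have h4 : d (eSol Φ σ) 2 = d (lieD Φ.toVForm σ) 2 := congrArg extD h1
    have h5 : d (lieD Φ.toVForm σ) 2 + lieD Φ.toVForm (d σ) 2 = 0 :=
      congrFun (d_lieD_add_lieD_d hΦ hσ) 2
    have h6 : (dDef Φ σ - lieD Φ.toVForm σ) 1 = d σ 1 := by
      change dDef Φ σ 1 - lieD Φ.toVForm σ 1 = d σ 1
      rw [← h1]
      exact sub_sub_cancel _ _
    have h7 := lieD_toVForm_congr Φ h6
    rw [lieD_toVForm_sub hΦ (hσ.dDef hΦ h) (hσ.lieD hΦ), hL σ hσ, sub_zero] at h7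
    rw [h7, h3]
    change -(d (eSol Φ σ) 2) = lieD Φ.toVForm (d σ) 2
    rw [h4, neg_eq_iff_add_eq_zero, h5]
  · have h0 : act (invField (rOp Φ)) σ 0 = σ 0 := by
      funext x
      ext v
      exact congrArg (σ 0 x) (Subsingleton.elim _ _)
    rw [dDef, chartRep_act _ _ _ x hx]
    change (chartRep (extD (act (invField (rOp Φ)) σ 0)) x _).compContinuousLinearMap _ = _
    rw [h0, hl]
    ext v
    have h1 := DFunLike.congr_fun (endRep_comp_eq_id x hx (invField_comp_rOp h)) (v 0)
    simp only [ContinuousLinearMap.comp_apply, ContinuousLinearMap.id_apply] at h1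
    exact congrArg l h1

theorem tfae_nijenhuisVanishes {Φ : EndField (E := E) M} (hΦ : IsSmoothEndField Φ)
    (h : IsInvertibleField (rOp Φ)) :
    List.TFAE [HasFiniteType Φ 0, IsDalethClosed 1 (eSol Φ), IsDalethClosed 1 (dDef Φ),
      NijenhuisVanishes Φ] := by
  tfae_have 2 ↔ 3 := by
    refine forall₂_congr fun σ hσ => ?_
    have hσ' : IsSmoothForms σ := hσ
    have h1 : daleth 1 (eSol Φ) σ = daleth 1 (dDef Φ) σ := by
      rw [daleth_one_apply, daleth_one_apply, eSol, eSol, (hσ'.dDef hΦ h).d_sub hσ'.d, d_d hσ',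
        sub_zero, sub_zero]
    rw [h1]
  tfae_have 2 → 4 := nijenhuisVanishes_of_isDalethClosed hΦ h
  tfae_have 4 → 2 := fun hN σ hσ => by
    have hσ' : IsSmoothForms σ := hσ
    rw [daleth_one_apply, eSol_eq_lieD hΦ h hN hσ', eSol_eq_lieD hΦ h hN hσ'.d,
      d_lieD_add_lieD_d hΦ hσ']
    rfl
  tfae_have 1 → 4 := fun h1 => nijenhuisVanishes_of_lieD_lieD hΦ h (hasFiniteType_zero_iff.1 h1)
  -- With `e_Φ = L_Φ`, the Maurer-Cartan equation reads `L_Φ² = -ℸ L_Φ = 0`.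
  tfae_have 4 → 1 := fun hN => hasFiniteType_zero_iff.2 fun σ hσ => by
    rw [← eSol_eq_lieD hΦ h hN hσ, ← eSol_eq_lieD hΦ h hN (hσ.eSol hΦ h), eSol_eSol hΦ h hσ,
      eSol_eq_lieD hΦ h hN hσ, eSol_eq_lieD hΦ h hN hσ.d, d_lieD_add_lieD_d hΦ hσ, neg_zero]
  tfae_finish

end MaurerCartan

/-! ### Almost complex structures and integrability. -/

section AlmostComplex

variable {E : Type*} [NormedAddCommGroup E] [NormedSpace ℝ E]
variable {M : Type*} [TopologicalSpace M] [ChartedSpace E M]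

theorem app_add (Φ : EndField (E := E) M) (X Y : VField (E := E) M) :
    Φ.app (X + Y) = Φ.app X + Φ.app Y := funext fun x => (Φ x).map_add _ _

theorem app_neg (Φ : EndField (E := E) M) (X : VField (E := E) M) :
    Φ.app (-X) = -Φ.app X := funext fun x => (Φ x).map_neg _

variable [IsManifold 𝓘(ℝ, E) ∞ M]

theorem IsSmoothEndField.app {Φ : EndField (E := E) M} (hΦ : IsSmoothEndField Φ)
    {X : VField (E := E) M} (hX : IsSmoothVField X) : IsSmoothVField (Φ.app X) :=
  ContMDiff.clm_bundle_apply hΦ hX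

theorem IsAlmostComplex.app_app {J : EndField (E := E) M} (hJ : IsAlmostComplex J)
    (X : VField (E := E) M) : J.app (J.app X) = -X :=
  funext fun x => DFunLike.congr_fun (hJ.2 x) (X x)

theorem IsAlmostComplex.isInvertibleField_rOp {J : EndField (E := E) M} (hJ : IsAlmostComplex J) :
    IsInvertibleField (rOp J) := fun x => by
  have hJJ : ∀ v, J x (J x v) = -v := DFunLike.congr_fun (hJ.2 x)
  -- Since `(1 + J)(1 - J) = 1 - J² = 2`, the inverse of `1 + J` is `(1 - J) / 2`.
  refine ContinuousLinearMap.IsInvertible.of_inverse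
    (g := (2 : ℝ)⁻¹ • (ContinuousLinearMap.id ℝ _ - J x)) ?_ ?_
  · ext v
    simp only [rOp, ContinuousLinearMap.comp_apply, add_apply, sub_apply, smul_apply,
      ContinuousLinearMap.id_apply, map_smul, map_sub, hJJ]
    module
  · ext v
    simp only [rOp, ContinuousLinearMap.comp_apply, add_apply, sub_apply, smul_apply,
      ContinuousLinearMap.id_apply, map_add, hJJ]
    module

/-- Fields of type `(0,1)` are exactly `X + iJX`. The bracket of two such has real part `[X, Y] -
[JX, JY]` and imaginary part `[X, JY] + [JX, Y]`, and `N_J (X, Y) = 0` says that `J` sends the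
imaginary part to minus the real part. -/
theorem IsAlmostComplex.nijenhuisVanishes_iff_isIntegrable {J : EndField (E := E) M}
    (hJ : IsAlmostComplex J) : NijenhuisVanishes J ↔ IsIntegrable J := by
  have hN : ∀ X Y : VField (E := E) M, nijenhuis J X Y =
      -(J.app (bracket X (J.app Y) + bracket (J.app X) Y)
        + (bracket X Y - bracket (J.app X) (J.app Y))) := fun X Y => by
    rw [nijenhuis, hJ.app_app, app_add]
    abel
  constructor
  · rintro h ⟨X, X'⟩ ⟨Y, Y'⟩ hX - hY - hZ hW
    obtain rfl : J.app X = X' := (Prod.ext_iff.1 hZ).1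
    obtain rfl : J.app Y = Y' := (Prod.ext_iff.1 hW).1
    have h1 := h X Y hX hY
    rw [hN, neg_eq_zero] at h1
    have h2 : J.app (bracket X (J.app Y) + bracket (J.app X) Y) =
      -(bracket X Y - bracket (J.app X) (J.app Y)) := eq_neg_of_add_eq_zero_left h1
    refine Prod.ext ?_ h2
    -- The other half of the type condition follows by applying `J` to `h2`.
    change J.app (bracket X Y - bracket (J.app X) (J.app Y)) = _
    rw [← neg_neg (bracket X Y - bracket (J.app X) (J.app Y)), ← h2, app_neg, hJ.app_app, neg_neg]
    rfl
  · intro h X Y hX hY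
    have h1 := h (X, J.app X) (Y, J.app Y) hX (hJ.1.app hX) hY (hJ.1.app hY)
      (Prod.ext rfl (hJ.app_app X)) (Prod.ext rfl (hJ.app_app Y))
    have h2 : J.app (bracket X (J.app Y) + bracket (J.app X) Y) =
      -(bracket X Y - bracket (J.app X) (J.app Y)) := (Prod.ext_iff.1 h1).2
    rw [hN, h2, neg_add_cancel, neg_zero]

end AlmostComplex

end GradedForms

theorem mainTheorem9 {E : Type*} [NormedAddCommGroup E] [NormedSpace ℝ E] [FiniteDimensional ℝ E]
    {M : Type*} [TopologicalSpace M] [ChartedSpace E M] [IsManifold 𝓘(ℝ, E) ∞ M]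
    [T2Space M] [SecondCountableTopology M] :
    (∀ Φ : GradedForms.EndField (E := E) M, GradedForms.IsSmoothEndField Φ →
      GradedForms.IsInvertibleField (GradedForms.rOp Φ) →
      List.TFAE [
        GradedForms.HasFiniteType Φ 0,
        GradedForms.IsDalethClosed 1 (GradedForms.eSol Φ),
        GradedForms.IsDalethClosed 1 (GradedForms.dDef Φ),
        GradedForms.NijenhuisVanishes Φ]) ∧
    (∀ J : GradedForms.EndField (E := E) M, GradedForms.IsAlmostComplex J →
      GradedForms.IsInvertibleField (GradedForms.rOp J) ∧
      List.TFAE [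
        GradedForms.HasFiniteType J 0,
        GradedForms.NijenhuisVanishes J,
        GradedForms.IsIntegrable J]) := by
  refine ⟨fun Φ hΦ h => GradedForms.tfae_nijenhuisVanishes hΦ h,
    fun J hJ => ⟨hJ.isInvertibleField_rOp, ?_⟩⟩
  have h := GradedForms.tfae_nijenhuisVanishes hJ.1 hJ.isInvertibleField_rOp
  tfae_have 1 ↔ 2 := h.out 0 3
  tfae_have 2 ↔ 3 := hJ.nijenhuisVanishes_iff_isIntegrable
  tfae_finish
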